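/- For an integer $n\ge 1$ and $a\in[0,1]^n$ (an aperture, indexed by $\mathbb Z/n$) let $\rho(a)=\frac1n\sum_i a_i$ be its transmissivity and $\hat a_k=\sum_j a_j e^{-2\pi i jk/n}$ its discrete Fourier transform. Let $\theta>0$ and let $W,J\ge 0$ be the thermal and shot noise levels, not both zero. For i.i.d. scenes (covariance spectrum $d_i=\theta/n$ for all $i$) the LMMSE of the aperture $a$ at exposure time $t>0$ is $$m(n,t,a)=\sum_{i=0}^{n-1}\frac{1}{\frac{1}{d_i}+\frac{t|\hat a_i|^2}{n(W+J\rho(a))}}$$ (the second term in a denominator is read as $0$ when $W=0$ and $a=0$), and $m^*(n,t)=\min_{a\in[0,1]^n}m(n,t,a)$. Call $a$ spectrally flat if all $a_i\in\{0,1\}$ and $|\hat a_i|$ is the same for all $i\neq 0$. For $C>1$ and a finite set $R\subset(0,1)$, say that $n$ is $(C,R)$-good if (i) for every $t>0$ there is $a\in[0,1]^n$ with $m(n,Ct,a)\le m^*(n,t)$; and (ii) there is a single spectrally flat $a$, with $|\rho(a)-r|<1/n$ for some $r\in R$, such that $m(n,Ct,a)\le m^*(n,t)$ for all $t$ with $\theta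 t\ge 4(W+J)$. **Proposition.** Let $\theta>0$ and $W,J\ge0$ with $W+J>0$ be fixed. Then: 1. there is $n>10^9$ that is $(8/7,\{1/8,1/4,1/2\})$-good; 2. there are more than $150$ values of $n<10^7$ that are $(4/3,\{1/4,1/2\})$-good, and there is also such an $n>10^9$. -/

import Mathlib

/-- The apertures of length `n`: the elements of `[0,1]^n`, indexed by the residues modulo `n`. -/
def Aperture (n : ℕ) : Set (ZMod n → ℝ) := {a | ∀ i, a i ∈ Set.Icc (0 : ℝ) 1}

/-- The transmissivity `ρ(a) = (1/n) ∑ i, a i`. -/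
noncomputable def transmissivity {n : ℕ} [NeZero n] (a : ZMod n → ℝ) : ℝ :=
  (1 / (n : ℝ)) * ∑ i, a i

/-- The unnormalized discrete Fourier transform of a real sequence, so that `â 0 = n ρ(a)`. -/
noncomputable def apertureDFT {n : ℕ} [NeZero n] (a : ZMod n → ℝ) : ZMod n → ℂ :=
  ZMod.dft (fun i => (a i : ℂ))

/-- The linear minimum mean square error `m(n,t,W,J,d,a)`: exposure time `t`, thermal noise `W`,
shot noise `J`, spectrum `d` of the covariance of the scene (all `d i > 0`), aperture `a`. -/
noncomputable def lmmse (n : ℕ) [NeZero n] (t W J : ℝ) (d a : ZMod n → ℝ) : ℝ :=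
  ∑ i, 1 / (1 / d i + t * ‖apertureDFT a i‖ ^ 2 / ((n : ℝ) * (W + J * transmissivity a)))

/-- The optimal value `m*(n,t,W,J,d)` of the linear minimum mean square error over all apertures. -/
noncomputable def optLmmse (n : ℕ) [NeZero n] (t W J : ℝ) (d : ZMod n → ℝ) : ℝ :=
  ⨅ a : Aperture n, lmmse n t W J d a

/-- The spectrum of an i.i.d. scene, `d i = θ / n` for all `i`. -/
noncomputable def iidSpectrum (n : ℕ) (θ : ℝ) : ZMod n → ℝ := fun _ => θ / (n : ℝ)

/-- A spectrally flat sequence: it takes only the values `0` and `1`, and the modulus of its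
discrete Fourier transform is constant on the nonzero frequencies. -/
def IsSpectrallyFlat {n : ℕ} [NeZero n] (a : ZMod n → ℝ) : Prop :=
  (∀ i, a i = 0 ∨ a i = 1) ∧
    ∀ i j : ZMod n, i ≠ 0 → j ≠ 0 → ‖apertureDFT a i‖ = ‖apertureDFT a j‖

/-- Optimality at length `n`, for i.i.d. scenes, up to the factor `C` in the exposure time.
First, at every exposure time some aperture attains the optimum within the factor `C`. Second, one
spectrally flat aperture, whose transmissivity is within `1 / n` of an element of `R`, does so
simultaneously for all exposure times `t` with `θ t ≥ 4 (W + J)`. -/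
def OptimalUpTo (C : ℝ) (R : Set ℝ) (θ W J : ℝ) (n : ℕ) [NeZero n] : Prop :=
  (∀ t : ℝ, 0 < t → ∃ a ∈ Aperture n,
    lmmse n (C * t) W J (iidSpectrum n θ) a ≤ optLmmse n t W J (iidSpectrum n θ)) ∧
  ∃ a ∈ Aperture n, IsSpectrallyFlat a ∧
    (∃ r ∈ R, |transmissivity a - r| < 1 / (n : ℝ)) ∧
    ∀ t : ℝ, 4 * (W + J) ≤ θ * t →
      lmmse n (C * t) W J (iidSpectrum n θ) a ≤ optLmmse n t W J (iidSpectrum n θ)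

/-!
The error of an aperture depends on its transmissivity `ρ` and on its energy at the nonzero
frequencies, which by Parseval is at most `n² ρ (1 - ρ)`. By convexity (Jensen) the error is at
least that of an ideal aperture, which spreads this energy evenly (`idealError_le_lmmse`), and
spectrally flat sequences are ideal (`lmmse_of_isSpectrallyFlat`). So flat sequences of density
about `1/2`, `1/4` or `1/8` have to be compared with ideal apertures of an arbitrary density `r`.

With the noise normalized to `W + J = 1`, the nonzero frequencies contribute through
`r (1 - r) / (W + J r)` and the zero frequency through `r² / (W + J r)`. Up to the factor `8/7`
(or `4/3`) one of the available densities beats every `r` at the nonzero frequencies; the extremal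
case is `W = 0`, where the optimal density is `0` and the density `1/8` (or `1/4`) loses exactly
this factor. What a larger `r` gains at the zero frequency is outweighed by what it loses at the
others as soon as `θ t ≥ 4 (W + J)`: by `two_term_le` only `θ t = 4 (W + J)` has to be considered,
and this is a polynomial inequality in `W` and `r` (`error_le_of_poly`). For a single exposure time
nothing is needed but the existence of an optimal aperture, which follows by compactness
(`exists_lmmse_le_optLmmse`).

The flat sequences are indicators of cyclic difference sets, all of density `(1 - 1 / n) / q`:
* Singer sets, for `q = 2, 4, 8` and a large `n` (`hasFlatSequence_singer`), whose Fourier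
  coefficients are Gauss sums of characters of `Lˣ` trivial on `Kˣ`;
* quadratic residues modulo primes `p ≡ 3 (mod 4)`, for `q = 2` (`hasFlatSequence_paley`);
* quartic residues modulo primes `p = 1 + 4 x²` with `x` odd, for `q = 4`
  (`hasFlatSequence_quartic`), where flatness amounts to the real part of the quartic Jacobi sum
  being `-1` (`re_jacobiSum_quartic`).
The last two families have more than `150` members below `10 ^ 7`. Which density is used depends
on `W / (W + J)` only.
-/

open scoped ComplexConjugate

/-! ### The spectrum of an aperture -/

lemma conj_apertureDFT {n : ℕ} [NeZero n] (a : ZMod n → ℝ) (k : ZMod n) :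
    conj (apertureDFT a k) = apertureDFT a (-k) := by
  simp only [apertureDFT, ZMod.dft_apply, map_sum, smul_eq_mul, map_mul, Complex.conj_ofReal]
  refine Finset.sum_congr rfl fun j _ => ?_
  rw [← AddChar.map_neg_eq_conj, mul_neg]

/-- Parseval's identity for the unnormalized Fourier transform on `ZMod n`. -/
lemma sum_norm_sq_apertureDFT {n : ℕ} [NeZero n] (a : ZMod n → ℝ) :
    ∑ k, ‖apertureDFT a k‖ ^ 2 = n * ∑ i, a i ^ 2 := by
  have h : ((∑ k, ‖apertureDFT a k‖ ^ 2 : ℝ) : ℂ) = ((n * ∑ i, a i ^ 2 : ℝ) : ℂ) := by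
    push_cast
    calc ∑ k, (‖apertureDFT a k‖ : ℂ) ^ 2
        = ∑ k, apertureDFT a k * apertureDFT a (-k) := by
          refine Finset.sum_congr rfl fun k _ => ?_
          rw [← conj_apertureDFT, Complex.mul_conj, Complex.normSq_eq_norm_sq]
          push_cast; rfl
      _ = ∑ k, ∑ j, (a j : ℂ) * (ZMod.stdAddChar (-(k * -j)) * apertureDFT a k) := by
          refine Finset.sum_congr rfl fun k _ => ?_
          have hk : apertureDFT a (-k) = ∑ j, ZMod.stdAddChar (-(j * -k)) * (a j : ℂ) :=
            ZMod.dft_apply _ _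
          rw [hk, Finset.mul_sum]
          refine Finset.sum_congr rfl fun j _ => ?_
          rw [show -(k * -j) = -(j * -k) by ring]
          ring
      _ = ∑ j, (a j : ℂ) * ZMod.dft (ZMod.dft fun i => (a i : ℂ)) (-j) := by
          rw [Finset.sum_comm]
          refine Finset.sum_congr rfl fun j _ => ?_
          rw [← Finset.mul_sum, ZMod.dft_apply (ZMod.dft _)]
          simp only [smul_eq_mul, apertureDFT]
      _ = n * ∑ i, (a i : ℂ) ^ 2 := by
          rw [ZMod.dft_dft, Finset.mul_sum]
          refine Finset.sum_congr rfl fun j _ => ?_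
          simp only [neg_neg, smul_eq_mul]
          ring
  exact_mod_cast h

lemma sum_eq_mul_transmissivity {n : ℕ} [NeZero n] (a : ZMod n → ℝ) :
    ∑ i, a i = n * transmissivity a := by
  have : (n : ℝ) ≠ 0 := NeZero.ne _
  rw [transmissivity]; field_simp

lemma norm_sq_apertureDFT_zero {n : ℕ} [NeZero n] (a : ZMod n → ℝ) :
    ‖apertureDFT a 0‖ ^ 2 = (n * transmissivity a) ^ 2 := by
  rw [apertureDFT, ZMod.dft_apply_zero, ← Complex.ofReal_sum, Complex.norm_real, Real.norm_eq_abs,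
    sq_abs, sum_eq_mul_transmissivity]

lemma transmissivity_mem_Icc {n : ℕ} [NeZero n] {a : ZMod n → ℝ} (ha : a ∈ Aperture n) :
    transmissivity a ∈ Set.Icc (0 : ℝ) 1 := by
  have hn : (0 : ℝ) < n := Nat.cast_pos.2 (NeZero.pos n)
  have h0 : 0 ≤ ∑ i, a i := Finset.sum_nonneg fun i _ => (ha i).1
  have h1 : ∑ i, a i ≤ n := by
    calc ∑ i, a i ≤ ∑ _i : ZMod n, (1 : ℝ) := Finset.sum_le_sum fun i _ => (ha i).2
      _ = n := by simp
  rw [transmissivity]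
  refine ⟨by positivity, ?_⟩
  rw [one_div, inv_mul_le_iff₀ hn]; linarith

lemma sum_erase_norm_sq_apertureDFT {n : ℕ} [NeZero n] (a : ZMod n → ℝ) :
    ∑ k ∈ Finset.univ.erase 0, ‖apertureDFT a k‖ ^ 2 =
      n * ∑ i, a i ^ 2 - (n * transmissivity a) ^ 2 := by
  rw [← sum_norm_sq_apertureDFT, ← norm_sq_apertureDFT_zero,
    ← Finset.add_sum_erase _ _ (Finset.mem_univ (0 : ZMod n))]
  ring

lemma sum_erase_norm_sq_apertureDFT_le {n : ℕ} [NeZero n] {a : ZMod n → ℝ}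
    (ha : a ∈ Aperture n) :
    ∑ k ∈ Finset.univ.erase 0, ‖apertureDFT a k‖ ^ 2 ≤
      (n : ℝ) ^ 2 * (transmissivity a * (1 - transmissivity a)) := by
  have h : ∑ i, a i ^ 2 ≤ n * transmissivity a := by
    rw [← sum_eq_mul_transmissivity]
    refine Finset.sum_le_sum fun i _ => ?_
    nlinarith [(ha i).1, (ha i).2]
  rw [sum_erase_norm_sq_apertureDFT]
  have hn : (0 : ℝ) ≤ n := Nat.cast_nonneg n
  nlinarith [mul_le_mul_of_nonneg_left h hn]

/-! ### The mean square error as a function of the transmissivity -/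

/-- The normalized error of an ideal aperture of length `n` and transmissivity `r`, that is, of one
whose whole energy `n² r (1 - r)` off the zero frequency is spread evenly over the `n - 1` nonzero
frequencies; here `T` is the exposure time multiplied by the variance `θ` of the scene. -/
noncomputable def idealError (n : ℕ) (T W J r : ℝ) : ℝ :=
  1 / (1 + T * (r ^ 2 / (W + J * r))) +
    (n - 1) / (1 + T * (r * (1 - r) / (W + J * r)) / (n - 1))

lemma lmmse_iid (n : ℕ) [NeZero n] {θ : ℝ} (hθ : 0 < θ) (t W J : ℝ) (a : ZMod n → ℝ) :
    lmmse n t W J (iidSpectrum n θ) a = θ / n *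
      ∑ i, 1 / (1 + θ * t * (‖apertureDFT a i‖ ^ 2 / n ^ 2 / (W + J * transmissivity a))) := by
  have hn : (0 : ℝ) < n := Nat.cast_pos.2 (NeZero.pos n)
  rw [lmmse, Finset.mul_sum]
  refine Finset.sum_congr rfl fun i _ => ?_
  rw [iidSpectrum]
  generalize W + J * transmissivity a = N
  have h : 1 / (θ / (n : ℝ)) + t * ‖apertureDFT a i‖ ^ 2 / (n * N) =
      (n / θ) * (1 + θ * t * (‖apertureDFT a i‖ ^ 2 / n ^ 2 / N)) := by
    rw [mul_add, mul_one, one_div_div, div_eq_mul_inv _ (n * N), mul_inv, div_eq_mul_inv _ N]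
    field_simp
  rw [h, one_div, mul_inv, inv_div, one_div]

/-- Jensen's inequality for `x ↦ 1 / (1 + x)`, in a form that uses only a bound for the sum. -/
lemma card_div_le_sum_one_div {ι : Type*} (s : Finset ι) {M S : ℝ} (y : ι → ℝ) (hM : 0 < M)
    (hs : (s.card : ℝ) = M) (hy : ∀ i ∈ s, 0 ≤ y i) (hS : ∑ i ∈ s, y i ≤ S) :
    M / (1 + S / M) ≤ ∑ i ∈ s, 1 / (1 + y i) := by
  have hS0 : 0 ≤ S := (Finset.sum_nonneg hy).trans hS
  set c := S / M with hc
  have hc0 : 0 ≤ c := by positivity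
  have hcM : M * c = S := by rw [hc]; field_simp
  -- the tangent to the convex function `1 / (1 + x)` at the mean `c`
  have tangent : ∀ i ∈ s, 1 / (1 + c) - (y i - c) / (1 + c) ^ 2 ≤ 1 / (1 + y i) := by
    intro i hi
    have h0 := hy i hi
    have h : 1 / (1 + y i) - (1 / (1 + c) - (y i - c) / (1 + c) ^ 2) =
        (y i - c) ^ 2 / ((1 + y i) * (1 + c) ^ 2) := by
      field_simp; ring
    have : 0 ≤ (y i - c) ^ 2 / ((1 + y i) * (1 + c) ^ 2) := by positivity
    linarith
  refine le_trans ?_ (Finset.sum_le_sum tangent)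
  rw [Finset.sum_sub_distrib, ← Finset.sum_div _ _ ((1 + c) ^ 2), Finset.sum_sub_distrib,
    Finset.sum_const, Finset.sum_const, nsmul_eq_mul, nsmul_eq_mul, hs, hcM, mul_one_div]
  have : (∑ i ∈ s, y i - S) / (1 + c) ^ 2 ≤ 0 :=
    div_nonpos_of_nonpos_of_nonneg (by linarith) (by positivity)
  linarith

lemma card_erase_zero (n : ℕ) [NeZero n] :
    (((Finset.univ.erase (0 : ZMod n)).card : ℕ) : ℝ) = n - 1 := by
  rw [Finset.card_erase_of_mem (Finset.mem_univ _), Finset.card_univ, ZMod.card,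
    Nat.cast_sub (NeZero.pos n), Nat.cast_one]

/-- No aperture does better than an ideal one of the same transmissivity. -/
lemma idealError_le_lmmse {n : ℕ} [NeZero n] (hn : 2 ≤ n) {θ t W J : ℝ} (hθ : 0 < θ) (ht : 0 ≤ t)
    (hW : 0 ≤ W) (hJ : 0 ≤ J) {a : ZMod n → ℝ} (ha : a ∈ Aperture n) :
    θ / n * idealError n (θ * t) W J (transmissivity a) ≤
      lmmse n t W J (iidSpectrum n θ) a := by
  have hn' : (2 : ℝ) ≤ n := by exact_mod_cast hn
  have hr := transmissivity_mem_Icc ha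
  have hN : 0 ≤ W + J * transmissivity a := by have := hr.1; positivity
  rw [lmmse_iid n hθ]
  refine mul_le_mul_of_nonneg_left ?_ (by positivity)
  rw [← Finset.add_sum_erase _ _ (Finset.mem_univ (0 : ZMod n)), idealError]
  refine add_le_add (le_of_eq ?_) ?_
  · rw [norm_sq_apertureDFT_zero, mul_pow, mul_div_cancel_left₀ _ (by positivity)]
  · refine card_div_le_sum_one_div _ _ (by linarith) (card_erase_zero n) (fun i _ => by positivity)
      ?_
    rw [← Finset.mul_sum, ← Finset.sum_div, ← Finset.sum_div]
    gcongr
    rw [div_le_iff₀ (by positivity)]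
    linarith [sum_erase_norm_sq_apertureDFT_le ha]

/-- Spectrally flat sequences are ideal. -/
lemma lmmse_of_isSpectrallyFlat {n : ℕ} [NeZero n] (hn : 2 ≤ n) {θ : ℝ} (hθ : 0 < θ) (t W J : ℝ)
    {a : ZMod n → ℝ} (ha : IsSpectrallyFlat a) :
    lmmse n t W J (iidSpectrum n θ) a =
      θ / n * idealError n (θ * t) W J (transmissivity a) := by
  have hn' : (2 : ℝ) ≤ n := by exact_mod_cast hn
  have hn1 : (n : ℝ) - 1 ≠ 0 := by linarith
  have hsq : ∑ i, a i ^ 2 = n * transmissivity a := by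
    rw [← sum_eq_mul_transmissivity]
    refine Finset.sum_congr rfl fun i _ => ?_
    rcases ha.1 i with h | h <;> simp [h]
  have key : ∀ i ∈ Finset.univ.erase (0 : ZMod n), ‖apertureDFT a i‖ ^ 2 / n ^ 2 =
      transmissivity a * (1 - transmissivity a) / (n - 1) := by
    intro i hi
    have h := sum_erase_norm_sq_apertureDFT a
    rw [Finset.sum_congr rfl fun j hj => by
      rw [ha.2 j i (Finset.ne_of_mem_erase hj) (Finset.ne_of_mem_erase hi)], Finset.sum_const,
      nsmul_eq_mul, card_erase_zero, hsq] at h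
    rw [div_eq_div_iff (by positivity) hn1]
    linarith
  rw [lmmse_iid n hθ, ← Finset.add_sum_erase _ _ (Finset.mem_univ (0 : ZMod n)), idealError]
  congr 2
  · rw [norm_sq_apertureDFT_zero, mul_pow, mul_div_cancel_left₀ _ (by positivity)]
  · rw [Finset.sum_congr rfl fun i hi => by rw [key i hi], Finset.sum_const, nsmul_eq_mul,
      card_erase_zero, mul_one_div]
    congr 2
    ring

/-! ### Existence of an optimal aperture -/

lemma isCompact_aperture (n : ℕ) [NeZero n] : IsCompact (Aperture n) := by
  have : Aperture n = Set.univ.pi fun _ => Set.Icc (0 : ℝ) 1 := by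
    ext a; simp only [Aperture, Set.mem_ofPred_eq, Set.mem_univ_pi]
  rw [this]
  exact isCompact_univ_pi fun _ => isCompact_Icc

lemma zero_mem_aperture (n : ℕ) : (0 : ZMod n → ℝ) ∈ Aperture n := fun _ => by simp

lemma continuous_transmissivity (n : ℕ) [NeZero n] :
    Continuous fun a : ZMod n → ℝ => transmissivity a := by
  unfold transmissivity; fun_prop

lemma continuous_apertureDFT (n : ℕ) [NeZero n] (i : ZMod n) :
    Continuous fun a : ZMod n → ℝ => apertureDFT a i := by
  simp only [apertureDFT, ZMod.dft_apply]
  fun_prop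

lemma norm_sq_apertureDFT_le {n : ℕ} [NeZero n] {a : ZMod n → ℝ} (ha : a ∈ Aperture n)
    (i : ZMod n) : ‖apertureDFT a i‖ ^ 2 / n ^ 2 ≤ transmissivity a ^ 2 := by
  have hn : (0 : ℝ) < n := Nat.cast_pos.2 (NeZero.pos n)
  have h : ‖apertureDFT a i‖ ≤ n * transmissivity a := by
    rw [← sum_eq_mul_transmissivity, apertureDFT, ZMod.dft_apply]
    refine (norm_sum_le _ _).trans (Finset.sum_le_sum fun j _ => ?_)
    rw [norm_smul, AddChar.norm_apply, one_mul, Complex.norm_real, Real.norm_eq_abs,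
      abs_of_nonneg (ha j).1]
  rw [div_le_iff₀ (by positivity), ← mul_pow, mul_comm (transmissivity a)]
  gcongr

/-- The only possible point of discontinuity is the zero aperture, when there is no thermal noise.
There the signal-to-noise ratio tends to `0`, since its numerator is quadratic in `a`. -/
lemma continuousOn_snr (n : ℕ) [NeZero n] {W J : ℝ} (hW : 0 ≤ W) (hJ : 0 ≤ J) (hWJ : 0 < W + J)
    (i : ZMod n) : ContinuousOn (fun a : ZMod n → ℝ =>
      ‖apertureDFT a i‖ ^ 2 / n ^ 2 / (W + J * transmissivity a)) (Aperture n) := by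
  intro a ha
  have hr := transmissivity_mem_Icc ha
  have hN0 : 0 ≤ W + J * transmissivity a := by have := hr.1; positivity
  rcases hN0.lt_or_eq with hN | hN
  · refine ContinuousAt.continuousWithinAt (ContinuousAt.div ?_ ?_ hN.ne')
    · exact (((continuous_apertureDFT n i).norm.pow 2).div_const _).continuousAt
    · exact (continuous_const.add (continuous_const.mul (continuous_transmissivity n))).continuousAt
  · have hJr : 0 ≤ J * transmissivity a := mul_nonneg hJ hr.1
    have hW0 : W = 0 := by linarith
    subst hW0
    have hJ0 : 0 < J := by linarith
    have hr0 : transmissivity a = 0 := by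
      rcases mul_eq_zero.1 (show J * transmissivity a = 0 by linarith) with h | h
      · exact absurd h hJ0.ne'
      · exact h
    have hlim : Filter.Tendsto (fun b : ZMod n → ℝ => transmissivity b / J)
        (nhdsWithin a (Aperture n)) (nhds 0) := by
      have := ((continuous_transmissivity n).div_const J).continuousWithinAt (s := Aperture n)
        (x := a)
      simpa only [ContinuousWithinAt, hr0, zero_div] using this
    rw [ContinuousWithinAt, hr0, mul_zero, add_zero, div_zero]
    refine squeeze_zero' ?_ ?_ hlim
    · filter_upwards [self_mem_nhdsWithin] with b hb
      have := (transmissivity_mem_Icc hb).1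
      positivity
    · filter_upwards [self_mem_nhdsWithin] with b hb
      have hb0 := (transmissivity_mem_Icc hb).1
      calc ‖apertureDFT b i‖ ^ 2 / n ^ 2 / (0 + J * transmissivity b)
          ≤ transmissivity b ^ 2 / (J * transmissivity b) := by
            rw [zero_add]
            gcongr
            exact norm_sq_apertureDFT_le hb i
        _ ≤ transmissivity b / J := by
            rcases hb0.lt_or_eq with h | h
            · apply le_of_eq; field_simp
            · simp [← h]

lemma snr_nonneg {n : ℕ} [NeZero n] {W J : ℝ} (hW : 0 ≤ W) (hJ : 0 ≤ J) {a : ZMod n → ℝ}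
    (ha : a ∈ Aperture n) (i : ZMod n) :
    0 ≤ ‖apertureDFT a i‖ ^ 2 / n ^ 2 / (W + J * transmissivity a) := by
  have := (transmissivity_mem_Icc ha).1
  positivity

/-- The optimum is attained, by compactness, and the error decreases with the exposure time. -/
lemma exists_lmmse_le_optLmmse (n : ℕ) [NeZero n] {θ t W J C : ℝ} (hθ : 0 < θ) (ht : 0 < t)
    (hW : 0 ≤ W) (hJ : 0 ≤ J) (hWJ : 0 < W + J) (hC : 1 ≤ C) :
    ∃ a ∈ Aperture n,
      lmmse n (C * t) W J (iidSpectrum n θ) a ≤ optLmmse n t W J (iidSpectrum n θ) := by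
  have hcont : ContinuousOn (fun a => lmmse n t W J (iidSpectrum n θ) a) (Aperture n) := by
    simp only [lmmse_iid n hθ]
    refine continuousOn_const.mul (continuousOn_finsetSum _ fun i _ => ?_)
    refine continuousOn_const.div (continuousOn_const.add
      (continuousOn_const.mul (continuousOn_snr n hW hJ hWJ i))) fun a ha => ?_
    have := snr_nonneg hW hJ ha i
    positivity
  obtain ⟨a, ha, hmin⟩ :=
    (isCompact_aperture n).exists_isMinOn ⟨0, zero_mem_aperture n⟩ hcont
  refine ⟨a, ha, ?_⟩
  have : Nonempty (Aperture n) := ⟨⟨0, zero_mem_aperture n⟩⟩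
  refine le_trans ?_ (le_ciInf fun b : Aperture n => isMinOn_iff.1 hmin b b.2)
  simp only [lmmse_iid n hθ]
  gcongr with i
  · have := snr_nonneg hW hJ ha i
    positivity
  · exact snr_nonneg hW hJ ha i
  · nlinarith

/-! ### The inequality between the errors of ideal apertures -/

/-- Comparison of two errors with parameters `v, g` and `u, f`. If `u ≤ v`, both terms compare.
Otherwise the loss in the first term has to be made up for by the gain in the second one, and it is
enough that this happens at `T = 4`: the ratio of the loss to the gain decreases with `T`. -/
lemma two_term_le {u v f g M T : ℝ} (hu : 0 ≤ u) (hv : 0 ≤ v) (hf : 0 ≤ f) (hM : 0 < M)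
    (hT : 4 ≤ T) (hfg : f ≤ g) (hgM : v < u → g / M ≤ v) (hfM : v < u → f / M ≤ u)
    (h4 : v < u → (u - v) * (1 + 4 * (f / M)) ≤ (g - f) * (1 + 4 * u)) :
    1 / (1 + T * v) + M / (1 + T * g / M) ≤ 1 / (1 + T * u) + M / (1 + T * f / M) := by
  have hg : 0 ≤ g := hf.trans hfg
  rcases le_or_gt u v with huv | huv
  · gcongr
  · have hg' := hgM huv
    have hf' := hfM huv
    have h := h4 huv
    set x := f / M with hx
    set y := g / M with hy
    have hx0 : 0 ≤ x := by positivity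
    have hy0 : 0 ≤ y := by positivity
    rw [mul_div_assoc, mul_div_assoc, ← hx, ← hy]
    have step : (u - v) * (1 + T * x) ≤ (g - f) * (1 + T * u) := by
      -- both sides are affine in `T`, the inequality holds at `T = 4`, and the slopes compare
      have slope : (u - v) * x ≤ (g - f) * u := by
        rcases le_or_gt (u - v) (g - f) with hle | hlt
        · exact mul_le_mul hle hf' hx0 (by linarith)
        · linarith
      nlinarith
    have step2 : (u - v) * (1 + T * x) * (1 + T * y) ≤ (g - f) * (1 + T * u) * (1 + T * v) := by
      refine mul_le_mul step ?_ (by positivity) ?_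
      · gcongr
      · have : 0 ≤ g - f := by linarith
        positivity
    have hgx : g - f = M * (y - x) := by rw [hx, hy]; field_simp
    have e1 : 1 / (1 + T * v) - 1 / (1 + T * u) =
        T * ((u - v) / ((1 + T * u) * (1 + T * v))) := by
      field_simp; ring
    have e2 : M / (1 + T * x) - M / (1 + T * y) =
        T * ((g - f) / ((1 + T * x) * (1 + T * y))) := by
      rw [hgx]; field_simp; ring
    have e3 : (u - v) / ((1 + T * u) * (1 + T * v)) ≤ (g - f) / ((1 + T * x) * (1 + T * y)) := by
      rw [div_le_div_iff₀ (by positivity) (by positivity)]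
      linarith
    have := mul_le_mul_of_nonneg_left e3 (show 0 ≤ T by linarith)
    linarith

lemma const_mul_le {p c C ρ : ℝ} (hp : 0 < p) (hp1 : p < 1) (hC : 1 ≤ C) (hρ : 0 < ρ)
    (hρp : ρ ≤ p) (hcρ : c * p ^ 2 ≤ C * ρ ^ 2) : c * (p * (1 - p)) ≤ C * (ρ * (1 - ρ)) := by
  have h3 : c * p ≤ C * ρ := by
    refine le_of_mul_le_mul_right ?_ hp
    calc c * p * p = c * p ^ 2 := by ring
      _ ≤ C * ρ ^ 2 := hcρ
      _ = C * ρ * ρ := by ring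
      _ ≤ C * ρ * p := by gcongr
  rw [← mul_assoc, ← mul_assoc]
  exact mul_le_mul h3 (by linarith) (by linarith) (by positivity)

/-- The condition of `two_term_le` at `T = 4`, from its version with denominators cleared. It is
monotone in `v` and `g`, which are replaced by their lower bounds `d / N0` and `e / N0`. -/
lemma gain_of_poly {d e k M r N N0 v g : ℝ} (hM : 0 < M) (hk : 1 + 4 / M ≤ k)
    (hr : 0 ≤ r) (hr1 : r ≤ 1) (hN : 0 < N) (hNr : r ≤ N) (hN0 : 0 < N0) (hv : d / N0 ≤ v)
    (hg : e / N0 ≤ g) (huv : v < r ^ 2 / N)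
    (h2 : k * (r ^ 2 * N0 - d * N) * N ≤ (e * N - r * (1 - r) * N0) * (N + 4 * r ^ 2)) :
    (r ^ 2 / N - v) * (1 + 4 * (r * (1 - r) / N / M)) ≤
      (g - r * (1 - r) / N) * (1 + 4 * (r ^ 2 / N)) := by
  have hr1' : 0 ≤ 1 - r := by linarith
  have e1 : k * (r ^ 2 / N - d / N0) = (k * (r ^ 2 * N0 - d * N) * N) / (N0 * N ^ 2) := by
    field_simp
  have e2 : (e / N0 - r * (1 - r) / N) * (1 + 4 * (r ^ 2 / N)) =
      ((e * N - r * (1 - r) * N0) * (N + 4 * r ^ 2)) / (N0 * N ^ 2) := by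
    field_simp
  have hpoly : k * (r ^ 2 / N - d / N0) ≤
      (e / N0 - r * (1 - r) / N) * (1 + 4 * (r ^ 2 / N)) := by
    rw [e1, e2]
    exact div_le_div_of_nonneg_right h2 (by positivity)
  have hu : 0 ≤ r ^ 2 / N := by positivity
  have hf : 0 ≤ r * (1 - r) / N := by positivity
  have hf1 : r * (1 - r) / N ≤ 1 := by
    rw [div_le_one hN]
    nlinarith
  generalize r * (1 - r) / N = f at *
  generalize r ^ 2 / N = u at *
  have hfM : 0 ≤ f / M := by positivity
  have hfk : 1 + 4 * (f / M) ≤ k := by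
    refine le_trans ?_ hk
    have : f / M ≤ 1 / M := by gcongr
    have e : 4 / M = 4 * (1 / M) := by ring
    linarith
  calc (u - v) * (1 + 4 * (f / M)) ≤ (u - d / N0) * k :=
        mul_le_mul (by linarith) hfk (by positivity) (by linarith)
    _ ≤ (e / N0 - f) * (1 + 4 * u) := by linarith
    _ ≤ (g - f) * (1 + 4 * u) := by gcongr

lemma div_div_le_of_le {M N x : ℝ} (hM : 0 < M) (hN : 0 < N) (hx : 0 < x)
    (h : 1 ≤ x * (M + 1)) : x * (1 - x) / N / M ≤ x ^ 2 / N := by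
  rw [div_div, div_le_div_iff₀ (by positivity) hN]
  have : 0 ≤ x * N * (x * (M + 1) - 1) := mul_nonneg (by positivity) (by linarith)
  linarith

/-- The reduction of the comparison between an ideal aperture of density `ρ ≈ p` and one of
density `r` to polynomial inequalities, with the noise normalized to `W + J = 1`. The constant `c`
stands for `C` minus the loss due to replacing `ρ` by `p`, and `k` for `1 + 4 / M`. -/
lemma error_le_of_poly {p C c k W ρ M T r : ℝ} (hp : 0 < p) (hp1 : p < 1) (hC : 1 ≤ C)
    (hW : 0 ≤ W) (hW1 : W ≤ 1) (hρ : 0 < ρ) (hρp : ρ ≤ p) (hcρ : c * p ^ 2 ≤ C * ρ ^ 2)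
    (hM : 0 < M) (hρM : 1 ≤ ρ * (M + 1)) (hk : 1 + 4 / M ≤ k) (hT : 4 ≤ T)
    (hr : 0 ≤ r) (hr1 : r ≤ 1)
    (h1 : r * (1 - r) * (W + (1 - W) * ρ) ≤ C * (ρ * (1 - ρ)) * (W + (1 - W) * r))
    (h2 : k * (r ^ 2 * (W + (1 - W) * p) - c * p ^ 2 * (W + (1 - W) * r)) *
        (W + (1 - W) * r) ≤
      (c * (p * (1 - p)) * (W + (1 - W) * r) -
        r * (1 - r) * (W + (1 - W) * p)) * (W + (1 - W) * r + 4 * r ^ 2)) :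
    1 / (1 + T * (C * (ρ ^ 2 / (W + (1 - W) * ρ)))) +
        M / (1 + T * (C * (ρ * (1 - ρ) / (W + (1 - W) * ρ))) / M) ≤
      1 / (1 + T * (r ^ 2 / (W + (1 - W) * r))) +
        M / (1 + T * (r * (1 - r) / (W + (1 - W) * r)) / M) := by
  have hJ : 0 ≤ 1 - W := by linarith
  have hρ1 : ρ < 1 := by linarith
  have hpos : ∀ x : ℝ, 0 < x → x ≤ 1 → x ≤ W + (1 - W) * x := fun x _ hx1 => by
    have : 0 ≤ W * (1 - x) := mul_nonneg hW (by linarith)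
    linarith
  have hN' : 0 < W + (1 - W) * ρ := hρ.trans_le (hpos ρ hρ hρ1.le)
  have hv : 0 ≤ C * (ρ ^ 2 / (W + (1 - W) * ρ)) := by positivity
  have hg : 0 ≤ C * (ρ * (1 - ρ) / (W + (1 - W) * ρ)) := by
    have : 0 ≤ 1 - ρ := by linarith
    positivity
  rcases hr.eq_or_lt with h0 | hr0
  · subst h0
    refine two_term_le ?_ hv ?_ hM hT ?_ ?_ ?_ ?_ <;> simp [hg, hv]
  have hNr : r ≤ W + (1 - W) * r := hpos r hr0 hr1
  have hN : 0 < W + (1 - W) * r := hr0.trans_le hNr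
  have hN0 : 0 < W + (1 - W) * p :=
    hp.trans_le (hpos p hp hp1.le)
  have hN'0 : W + (1 - W) * ρ ≤ W + (1 - W) * p := by gcongr
  have hr1' : 0 ≤ 1 - r := by linarith
  have hf : 0 ≤ r * (1 - r) / (W + (1 - W) * r) := by positivity
  have hfg : r * (1 - r) / (W + (1 - W) * r) ≤ C * (ρ * (1 - ρ) / (W + (1 - W) * ρ)) := by
    rw [← mul_div_assoc, div_le_div_iff₀ hN hN']
    exact h1
  -- the first term of the error is already smaller unless `ρ ≤ r`
  have hρr : C * (ρ ^ 2 / (W + (1 - W) * ρ)) < r ^ 2 / (W + (1 - W) * r) → ρ ≤ r := by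
    intro h
    by_contra hlt
    push Not at hlt
    have : r ^ 2 / (W + (1 - W) * r) ≤ ρ ^ 2 / (W + (1 - W) * ρ) := by
      rw [div_le_div_iff₀ hN hN']
      have hd : 0 ≤ ρ - r := by linarith
      have : 0 ≤ W * (ρ - r) * (ρ + r) + (1 - W) * (ρ * r) * (ρ - r) := by positivity
      linarith
    have h3 : ρ ^ 2 / (W + (1 - W) * ρ) ≤ C * (ρ ^ 2 / (W + (1 - W) * ρ)) :=
      le_mul_of_one_le_left (by positivity) hC
    linarith
  refine two_term_le (by positivity) hv hf hM hT hfg ?_ ?_ ?_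
  · intro _
    rw [mul_div_assoc]
    refine mul_le_mul_of_nonneg_left ?_ (by linarith)
    exact div_div_le_of_le hM hN' hρ (by linarith)
  · intro h
    have := mul_le_mul_of_nonneg_right (hρr h) (show 0 ≤ M + 1 by linarith)
    exact div_div_le_of_le hM hN hr0 (by linarith)
  · intro huv
    have h4 := const_mul_le hp hp1 hC hρ hρp hcρ
    refine gain_of_poly (d := c * p ^ 2) (e := c * (p * (1 - p))) hM hk hr hr1 hN hNr hN0 ?_ ?_
      huv h2
    · rw [← mul_div_assoc]
      exact div_le_div₀ (by positivity) hcρ hN' hN'0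
    · rw [← mul_div_assoc]
      have h5 : 0 ≤ 1 - ρ := by linarith
      exact div_le_div₀ (by positivity) h4 hN' hN'0

/-! ### Polynomial inequalities -/

/-- A quadratic polynomial on an interval is a nonnegative combination of its Bernstein
coefficients, the middle one of which is computed from the value at the midpoint. -/
lemma quadratic_nonneg {A B D x a b : ℝ} (hab : a < b) (hx : a ≤ x) (hxb : x ≤ b)
    (h0 : 0 ≤ A + B * a + D * a ^ 2) (h1 : 0 ≤ A + B * ((a + b) / 2) + D * (a * b))
    (h2 : 0 ≤ A + B * b + D * b ^ 2) : 0 ≤ A + B * x + D * x ^ 2 := by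
  have hp : 0 ≤ x - a := by linarith
  have hm : 0 ≤ b - x := by linarith
  have e : (A + B * x + D * x ^ 2) * (b - a) ^ 2 =
      (A + B * a + D * a ^ 2) * (b - x) ^ 2 +
        2 * (A + B * ((a + b) / 2) + D * (a * b)) * ((x - a) * (b - x)) +
        (A + B * b + D * b ^ 2) * (x - a) ^ 2 := by ring
  have : 0 ≤ (A + B * x + D * x ^ 2) * (b - a) ^ 2 := by rw [e]; positivity
  exact nonneg_of_mul_nonneg_left this (by have := sub_pos.2 hab; positivity)

/-- The difference of the two sides of the polynomial inequality, as a polynomial in `W`. -/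
lemma poly_le_of_quadratic {c k W r p a b : ℝ} (hab : a < b) (hx : a ≤ W) (hxb : W ≤ b)
    (h : ∀ A B D : ℝ,
      A = (c * (p * (1 - p)) * r - r * (1 - r) * p) * (r + 4 * r ^ 2) -
        k * (r ^ 2 * p - c * p ^ 2 * r) * r →
      B = (c * (p * (1 - p)) * (1 - r) - r * (1 - r) * (1 - p)) * (r + 4 * r ^ 2) +
        (c * (p * (1 - p)) * r - r * (1 - r) * p) * (1 - r) -
        k * (r ^ 2 * (1 - p) - c * p ^ 2 * (1 - r)) * r -
        k * (r ^ 2 * p - c * p ^ 2 * r) * (1 - r) →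
      D = (c * (p * (1 - p)) * (1 - r) - r * (1 - r) * (1 - p)) * (1 - r) -
        k * (r ^ 2 * (1 - p) - c * p ^ 2 * (1 - r)) * (1 - r) →
      0 ≤ A + B * a + D * a ^ 2 ∧ 0 ≤ A + B * ((a + b) / 2) + D * (a * b) ∧
        0 ≤ A + B * b + D * b ^ 2) :
    k * (r ^ 2 * (W + (1 - W) * p) - c * p ^ 2 * (W + (1 - W) * r)) * (W + (1 - W) * r) ≤
      (c * (p * (1 - p)) * (W + (1 - W) * r) - r * (1 - r) * (W + (1 - W) * p)) *
        (W + (1 - W) * r + 4 * r ^ 2) := by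
  obtain ⟨h0, h1, h2⟩ := h _ _ _ rfl rfl rfl
  have := quadratic_nonneg hab hx hxb h0 h1 h2
  rw [← sub_nonneg]
  refine this.trans_eq ?_
  ring

/-- The polynomial inequality for the density `p = 1 / 8` and small thermal noise. The constants are
`999 / 875 = 8 / 7 * (1 - 1 / 1000)` and `1001 / 1000`, which leave room for lengths `n ≥ 10 ^ 4`.
As in its companions below, each Bernstein coefficient in `W` is a quartic in `r`. -/
lemma poly_le_eighth {W r : ℝ} (h0 : 0 ≤ r) (hW : 0 ≤ W) (hW' : W ≤ 1 / 20) :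
    1001 / 1000 * (r ^ 2 * (W + (1 - W) * (1 / 8)) -
      999 / 875 * (1 / 8) ^ 2 * (W + (1 - W) * r)) *
        (W + (1 - W) * r) ≤
      (999 / 875 * ((1 / 8) * (1 - 1 / 8)) * (W + (1 - W) * r) -
          r * (1 - r) * (W + (1 - W) * (1 / 8))) *
        (W + (1 - W) * r + 4 * r ^ 2) := by
  refine poly_le_of_quadratic (by norm_num) hW hW' fun A B D hA hB hD => ⟨?_, ?_, ?_⟩
  · rw [hA, hB, hD]
    nlinarith [sq_nonneg r, mul_nonneg (sq_nonneg r) (sq_nonneg (r - 1 / 10))]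
  · rw [hA, hB, hD]
    nlinarith [sq_nonneg r,
      mul_nonneg h0 (mul_nonneg h0 (sq_nonneg (r - 1 / 10))),
      mul_nonneg h0 (sq_nonneg (r - 1 / 10))]
  · rw [hA, hB, hD]
    nlinarith [sq_nonneg (r ^ 2 - 149 / 1000 * r - 3 / 200), sq_nonneg (r - 1 / 5)]

lemma poly_le_quarter {W r : ℝ} (h0 : 0 ≤ r) (hW : 1 / 20 ≤ W) (hW' : W ≤ 43 / 200) :
    1001 / 1000 * (r ^ 2 * (W + (1 - W) * (1 / 4)) -
      999 / 875 * (1 / 4) ^ 2 * (W + (1 - W) * r)) *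
        (W + (1 - W) * r) ≤
      (999 / 875 * ((1 / 4) * (1 - 1 / 4)) * (W + (1 - W) * r) -
          r * (1 - r) * (W + (1 - W) * (1 / 4))) *
        (W + (1 - W) * r + 4 * r ^ 2) := by
  refine poly_le_of_quadratic (by norm_num) hW hW' fun A B D hA hB hD => ⟨?_, ?_, ?_⟩
  · rw [hA, hB, hD]
    nlinarith [sq_nonneg (r ^ 2 - 6 / 41 * r - 19 / 1000), sq_nonneg (r + 1 / 15), h0]
  · rw [hA, hB, hD]
    nlinarith [sq_nonneg (r ^ 2 - 15 / 64 * r - 43 / 1000), sq_nonneg r, h0]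
  · rw [hA, hB, hD]
    nlinarith [sq_nonneg (r ^ 2 - 21 / 71 * r - 47 / 1000), sq_nonneg (r - 2 / 5), h0]

lemma poly_le_half {W r : ℝ} (h0 : 0 ≤ r) (hW : 43 / 200 ≤ W) (hW' : W ≤ 1) :
    1001 / 1000 * (r ^ 2 * (W + (1 - W) * (1 / 2)) -
      999 / 875 * (1 / 2) ^ 2 * (W + (1 - W) * r)) *
        (W + (1 - W) * r) ≤
      (999 / 875 * ((1 / 2) * (1 - 1 / 2)) * (W + (1 - W) * r) -
          r * (1 - r) * (W + (1 - W) * (1 / 2))) *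
        (W + (1 - W) * r + 4 * r ^ 2) := by
  refine poly_le_of_quadratic (by norm_num) hW hW' fun A B D hA hB hD => ⟨?_, ?_, ?_⟩
  · rw [hA, hB, hD]
    nlinarith [sq_nonneg (r ^ 2 - 6 / 19 * r - 41 / 1000), sq_nonneg r, h0]
  · rw [hA, hB, hD]
    nlinarith [sq_nonneg (r ^ 2 - 34 / 79 * r - 9 / 125), sq_nonneg (r - 9 / 19), h0]
  · rw [hA, hB, hD]
    nlinarith [sq_nonneg (r ^ 2 - 1 / 2 * r - 3 / 25), sq_nonneg (r - 2 / 3), h0]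

/-- The version for the factor `4 / 3` and lengths `n ≥ 101`, where
`98 / 75 = 4 / 3 * (1 - 1 / 50)`. -/
lemma poly_le_quarter' {W r : ℝ} (h0 : 0 ≤ r) (hW : 0 ≤ W) (hW' : W ≤ 1 / 4) :
    104 / 100 * (r ^ 2 * (W + (1 - W) * (1 / 4)) -
      98 / 75 * (1 / 4) ^ 2 * (W + (1 - W) * r)) *
        (W + (1 - W) * r) ≤
      (98 / 75 * ((1 / 4) * (1 - 1 / 4)) * (W + (1 - W) * r) -
          r * (1 - r) * (W + (1 - W) * (1 / 4))) *
        (W + (1 - W) * r + 4 * r ^ 2) := by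
  refine poly_le_of_quadratic (by norm_num) hW hW' fun A B D hA hB hD => ⟨?_, ?_, ?_⟩
  · rw [hA, hB, hD]
    nlinarith [sq_nonneg r,
      mul_nonneg h0 (mul_nonneg h0 (sq_nonneg (r - 1 / 10))),
      mul_nonneg h0 (sq_nonneg (r - 1 / 5))]
  · rw [hA, hB, hD]
    nlinarith [sq_nonneg r,
      mul_nonneg h0 (mul_nonneg h0 (sq_nonneg (r - 1 / 10))),
      mul_nonneg h0 (sq_nonneg (r - 1 / 5))]
  · rw [hA, hB, hD]
    nlinarith [sq_nonneg (r ^ 2 - 27 / 92 * r - 2 / 125), sq_nonneg (r - 1 / 3), h0]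

lemma poly_le_half' {W r : ℝ} (h0 : 0 ≤ r) (hW : 1 / 4 ≤ W) (hW' : W ≤ 1) :
    104 / 100 * (r ^ 2 * (W + (1 - W) * (1 / 2)) -
      98 / 75 * (1 / 2) ^ 2 * (W + (1 - W) * r)) *
        (W + (1 - W) * r) ≤
      (98 / 75 * ((1 / 2) * (1 - 1 / 2)) * (W + (1 - W) * r) -
          r * (1 - r) * (W + (1 - W) * (1 / 2))) *
        (W + (1 - W) * r + 4 * r ^ 2) := by
  refine poly_le_of_quadratic (by norm_num) hW hW' fun A B D hA hB hD => ⟨?_, ?_, ?_⟩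
  · rw [hA, hB, hD]
    nlinarith [sq_nonneg (r ^ 2 - 4 / 13 * r - 61 / 1000), sq_nonneg r, h0]
  · rw [hA, hB, hD]
    nlinarith [sq_nonneg (r ^ 2 - 38 / 89 * r - 29 / 1000), sq_nonneg (r - 9 / 20), h0]
  · rw [hA, hB, hD]
    nlinarith [sq_nonneg (r ^ 2 - 1 / 2 * r - 11 / 100), sq_nonneg (r - 5 / 8), h0]

/-! ### Optimality of spectrally flat apertures -/

/-- The comparison of the contributions of the nonzero frequencies, from that of the limit density
`p` with the smaller constant `c`. -/
lemma cross_le_of_slack {p c C ρ W r : ℝ} (hp : 0 < p) (hp1 : p < 1) (hC : 1 ≤ C) (hW : 0 ≤ W)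
    (hW1 : W ≤ 1) (hρ : 0 < ρ) (hρp : ρ ≤ p) (hcρ : c * p ^ 2 ≤ C * ρ ^ 2) (hr : 0 ≤ r)
    (hr1 : r ≤ 1)
    (h : r * (1 - r) * (W + (1 - W) * p) ≤ c * (p * (1 - p)) * (W + (1 - W) * r)) :
    r * (1 - r) * (W + (1 - W) * ρ) ≤ C * (ρ * (1 - ρ)) * (W + (1 - W) * r) := by
  have h1 : 0 ≤ 1 - r := by linarith
  have h2 : 0 ≤ 1 - W := by linarith
  calc r * (1 - r) * (W + (1 - W) * ρ) ≤ r * (1 - r) * (W + (1 - W) * p) := by gcongr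
    _ ≤ _ := h
    _ ≤ _ := mul_le_mul_of_nonneg_right (const_mul_le hp hp1 hC hρ hρp hcρ) (by positivity)

/-- Without thermal noise there is no room for replacing `ρ` by its limit `p`, but the inequality is
affine in `W` and holds for `W = 0` because `1 ≤ C (1 - p)`. -/
lemma cross_le_of_endpoint {p C ρ W b r : ℝ} (hC : 0 ≤ C) (hCp : 1 ≤ C * (1 - p)) (hρ : 0 < ρ)
    (hρp : ρ ≤ p) (hW : 0 ≤ W) (hWb : W ≤ b) (hb : 0 < b) (hr : 0 ≤ r)
    (h : r * (1 - r) * (b + (1 - b) * ρ) ≤ C * (ρ * (1 - ρ)) * (b + (1 - b) * r)) :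
    r * (1 - r) * (W + (1 - W) * ρ) ≤ C * (ρ * (1 - ρ)) * (W + (1 - W) * r) := by
  have h0 : 0 ≤ ρ * r * (C * (1 - ρ) - (1 - r)) := by
    have h2 : C * (1 - p) ≤ C * (1 - ρ) := by gcongr
    have h3 : 0 ≤ C * (1 - ρ) - (1 - r) := by linarith
    positivity
  have h1 := mul_nonneg (sub_nonneg.2 hWb) h0
  have h2 := mul_nonneg hW (sub_nonneg.2 h)
  refine le_of_mul_le_mul_left ?_ hb
  linarith

lemma idealError_normalize (n : ℕ) {W J : ℝ} (hWJ : 0 < W + J) (T r : ℝ) :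
    idealError n T W J r = idealError n (T / (W + J)) (W / (W + J)) (1 - W / (W + J)) r := by
  have h : W / (W + J) + (1 - W / (W + J)) * r = (W + J * r) / (W + J) := by field_simp; ring
  have e : ∀ x : ℝ, T / (W + J) * (x / ((W + J * r) / (W + J))) = T * (x / (W + J * r)) := by
    intro x
    rw [div_div_eq_mul_div, div_mul_div_comm, ← mul_assoc, mul_comm (W + J) (W + J * r),
      mul_div_mul_right _ _ hWJ.ne', mul_div_assoc]
  rw [idealError, idealError, h, e, e]

/-- If the comparison of ideal errors reduces to the polynomial inequality for the given noise
levels, a spectrally flat aperture of density `(1 - 1 / n) p` is optimal up to the factor `C`. -/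
lemma optimalUpTo_of_isSpectrallyFlat {n : ℕ} [NeZero n] {p C c k θ W J w : ℝ} {R : Set ℝ}
    (hθ : 0 < θ) (hW : 0 ≤ W) (hJ : 0 ≤ J) (hWJ : 0 < W + J) (hw : w = W / (W + J))
    (hp : 0 < p) (hp1 : p < 1) (hC : 1 ≤ C) (hn : 2 ≤ n) (hc : c ≤ C * (1 - 1 / n) ^ 2)
    (hk : 1 + 4 / ((n : ℝ) - 1) ≤ k) (hnp : 1 ≤ ((n : ℝ) - 1) * p) (hpR : p ∈ R)
    {a : ZMod n → ℝ} (ha : IsSpectrallyFlat a) (hρ : transmissivity a = (1 - 1 / n) * p)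
    (hcross : ∀ ρ r : ℝ, 0 < ρ → ρ ≤ p → c * p ^ 2 ≤ C * ρ ^ 2 → 0 ≤ r → r ≤ 1 →
      r * (1 - r) * (w + (1 - w) * ρ) ≤ C * (ρ * (1 - ρ)) * (w + (1 - w) * r))
    (hpoly : ∀ r : ℝ, 0 ≤ r → r ≤ 1 →
      k * (r ^ 2 * (w + (1 - w) * p) - c * p ^ 2 * (w + (1 - w) * r)) * (w + (1 - w) * r) ≤
        (c * (p * (1 - p)) * (w + (1 - w) * r) - r * (1 - r) * (w + (1 - w) * p)) *
          (w + (1 - w) * r + 4 * r ^ 2)) :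
    OptimalUpTo C R θ W J n := by
  have hn' : (2 : ℝ) ≤ n := by exact_mod_cast hn
  have hninv : 1 / (n : ℝ) ≤ 1 / 2 := one_div_le_one_div_of_le (by norm_num) hn'
  have hninv0 : 0 < 1 / (n : ℝ) := by positivity
  refine ⟨fun t ht => exists_lmmse_le_optLmmse n hθ ht hW hJ hWJ hC, a, fun i => ?_, ha,
    ⟨p, hpR, ?_⟩, fun t ht => ?_⟩
  · rcases ha.1 i with h | h <;> simp [h]
  · rw [hρ, show (1 - 1 / (n : ℝ)) * p - p = -(1 / n * p) by ring, abs_neg,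
      abs_of_nonneg (by positivity)]
    exact mul_lt_of_lt_one_right hninv0 hp1
  have ht0 : 0 ≤ t := by
    by_contra h
    push Not at h
    nlinarith [mul_neg_of_pos_of_neg hθ h]
  have : Nonempty (Aperture n) := ⟨⟨0, zero_mem_aperture n⟩⟩
  refine le_ciInf fun b => le_trans ?_ (idealError_le_lmmse hn hθ ht0 hW hJ b.2)
  rw [lmmse_of_isSpectrallyFlat hn hθ _ _ _ ha]
  refine mul_le_mul_of_nonneg_left ?_ (by positivity)
  obtain ⟨hr0, hr1⟩ := transmissivity_mem_Icc b.2
  rw [idealError_normalize n hWJ, idealError_normalize n hWJ (θ * t), ← hw]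
  generalize transmissivity (b : ZMod n → ℝ) = r at *
  have hT : 4 ≤ θ * t / (W + J) := by rwa [le_div_iff₀ hWJ]
  have hw0 : 0 ≤ w := by rw [hw]; positivity
  have hw1 : w ≤ 1 := by rw [hw, div_le_one hWJ]; linarith
  have hCT : θ * (C * t) / (W + J) = θ * t / (W + J) * C := by ring
  have hρ0 : 0 < (1 - 1 / (n : ℝ)) * p := mul_pos (by linarith) hp
  have hρp : (1 - 1 / (n : ℝ)) * p ≤ p := mul_le_of_le_one_left hp.le (by linarith)
  have hcρ : c * p ^ 2 ≤ C * ((1 - 1 / (n : ℝ)) * p) ^ 2 := by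
    rw [mul_pow, ← mul_assoc]
    gcongr
  have hnn : (1 - 1 / (n : ℝ)) * p * ((n : ℝ) - 1 + 1) = ((n : ℝ) - 1) * p := by
    field_simp; ring
  rw [hCT, hρ, idealError, idealError]
  simp only [mul_assoc (θ * t / (W + J)) C]
  exact error_le_of_poly hp hp1 hC hw0 hw1 hρ0 hρp hcρ (by linarith) (by rw [hnn]; exact hnp) hk hT
    hr0 hr1 (hcross _ r hρ0 hρp hcρ hr0 hr1) (hpoly r hr0 hr1)

/-- There is a spectrally flat 0-1 sequence of length `n` with `(n - 1) / q` ones. -/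
def HasFlatSequence (q n : ℕ) [NeZero n] : Prop :=
  ∃ a : ZMod n → ℝ, IsSpectrallyFlat a ∧ q * ∑ i, a i = n - 1

lemma HasFlatSequence.exists_transmissivity {q n : ℕ} [NeZero n] (hq : q ≠ 0)
    (h : HasFlatSequence q n) :
    ∃ a : ZMod n → ℝ, IsSpectrallyFlat a ∧ transmissivity a = (1 - 1 / n) * (1 / q) := by
  obtain ⟨a, ha, hs⟩ := h
  refine ⟨a, ha, ?_⟩
  have hn : (n : ℝ) ≠ 0 := NeZero.ne _
  have hq' : (q : ℝ) ≠ 0 := by exact_mod_cast hq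
  rw [transmissivity]
  field_simp
  linarith

lemma length_estimates {n : ℕ} {C c k N : ℝ} (hC : 0 ≤ C) (hN : 2 ≤ N) (hnN : N ≤ n)
    (hc : c ≤ C * (1 - 1 / N) ^ 2) (hk : 1 + 4 / (N - 1) ≤ k) :
    c ≤ C * (1 - 1 / n) ^ 2 ∧ 1 + 4 / ((n : ℝ) - 1) ≤ k := by
  constructor
  · refine hc.trans ?_
    have : 0 ≤ 1 - 1 / N := by
      have : 1 / N ≤ 1 := by rw [div_le_one (by linarith)]; linarith
      linarith
    gcongr
  · refine le_trans ?_ hk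
    have : 0 < N - 1 := by linarith
    gcongr

/-- With the densities `1/8`, `1/4`, `1/2` at hand, the factor `8/7` is lost at most: it is exactly
the loss of the density `1/8` against the density `0`, which is optimal without thermal noise. -/
lemma optimalUpTo_eight_sevenths {θ W J : ℝ} (hθ : 0 < θ) (hW : 0 ≤ W) (hJ : 0 ≤ J)
    (hWJ : 0 < W + J) :
    ∃ q ∈ ({2, 4, 8} : Set ℕ), ∀ (n : ℕ) [NeZero n], 10 ^ 4 ≤ n → HasFlatSequence q n →
      OptimalUpTo (8 / 7) {1 / 8, 1 / 4, 1 / 2} θ W J n := by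
  have hw0 : 0 ≤ W / (W + J) := by positivity
  have hw1 : W / (W + J) ≤ 1 := by rw [div_le_one hWJ]; linarith
  have est : ∀ n : ℕ, 10 ^ 4 ≤ n → (2 ≤ n ∧ (10 ^ 4 : ℝ) ≤ n) ∧
      (999 / 875 : ℝ) ≤ 8 / 7 * (1 - 1 / n) ^ 2 ∧ 1 + 4 / ((n : ℝ) - 1) ≤ 1001 / 1000 := by
    intro n hn
    have hn' : (10 ^ 4 : ℝ) ≤ n := by exact_mod_cast hn
    exact ⟨⟨by omega, hn'⟩,
      length_estimates (N := 10 ^ 4) (by norm_num) (by norm_num) hn' (by norm_num) (by norm_num)⟩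
  -- at `1 / 20` and `43 / 200` both of the adjacent densities satisfy all inequalities
  rcases le_or_gt (W / (W + J)) (1 / 20) with h1 | h1
  · refine ⟨8, by simp, fun n _ hn hf => ?_⟩
    obtain ⟨⟨hn2, hn'⟩, hc, hk⟩ := est n hn
    obtain ⟨a, ha, hρ⟩ := hf.exists_transmissivity (by norm_num)
    refine optimalUpTo_of_isSpectrallyFlat (p := 1 / 8) hθ hW hJ hWJ rfl (by norm_num)
      (by norm_num) (by norm_num) hn2 hc hk (by linarith) (by simp) ha (by simpa using hρ) ?_ ?_
    · intro ρ r hρ0 hρ1 hcρ hr0 hr1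
      refine cross_le_of_endpoint (by norm_num) (by norm_num) hρ0 hρ1 hw0 h1 (by norm_num) hr0 ?_
      refine cross_le_of_slack (by norm_num) (by norm_num) (by norm_num) (by norm_num)
        (by norm_num) hρ0 hρ1 hcρ hr0 hr1 ?_
      nlinarith [sq_nonneg (r - 3 / 20)]
    · exact fun r hr0 hr1 => poly_le_eighth hr0 hw0 h1
  rcases le_or_gt (W / (W + J)) (43 / 200) with h2 | h2
  · refine ⟨4, by simp, fun n _ hn hf => ?_⟩
    obtain ⟨⟨hn2, hn'⟩, hc, hk⟩ := est n hn
    obtain ⟨a, ha, hρ⟩ := hf.exists_transmissivity (by norm_num)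
    refine optimalUpTo_of_isSpectrallyFlat (p := 1 / 4) hθ hW hJ hWJ rfl (by norm_num)
      (by norm_num) (by norm_num) hn2 hc hk (by linarith) (by simp) ha (by simpa using hρ) ?_ ?_
    · intro ρ r hρ0 hρ1 hcρ hr0 hr1
      refine cross_le_of_slack (by norm_num) (by norm_num) (by norm_num) hw0 hw1
        hρ0 hρ1 hcρ hr0 hr1 ?_
      generalize W / (W + J) = w at *
      nlinarith [mul_nonneg (sub_nonneg.2 h1.le) (sq_nonneg (r - 7 / 24)),
        mul_nonneg (sub_nonneg.2 h2) (sq_nonneg (r - 7 / 48))]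
    · exact fun r hr0 hr1 => poly_le_quarter hr0 h1.le h2
  · refine ⟨2, by simp, fun n _ hn hf => ?_⟩
    obtain ⟨⟨hn2, hn'⟩, hc, hk⟩ := est n hn
    obtain ⟨a, ha, hρ⟩ := hf.exists_transmissivity (by norm_num)
    refine optimalUpTo_of_isSpectrallyFlat (p := 1 / 2) hθ hW hJ hWJ rfl (by norm_num)
      (by norm_num) (by norm_num) hn2 hc hk (by linarith) (by simp) ha (by simpa using hρ) ?_ ?_
    · intro ρ r hρ0 hρ1 hcρ hr0 hr1
      refine cross_le_of_slack (by norm_num) (by norm_num) (by norm_num) hw0 hw1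
        hρ0 hρ1 hcρ hr0 hr1 ?_
      generalize W / (W + J) = w at *
      nlinarith [mul_nonneg (sub_nonneg.2 h2.le) (sq_nonneg (r - 1 / 2)),
        mul_nonneg (sub_nonneg.2 hw1) (sq_nonneg (r - 63 / 200))]
    · exact fun r hr0 hr1 => poly_le_half hr0 h2.le hw1

/-- With the densities `1/4` and `1/2` at hand, the factor `4/3` is lost at most: it is exactly the
loss of the density `1/4` against the density `0`, which is optimal without thermal noise. -/
lemma optimalUpTo_four_thirds {θ W J : ℝ} (hθ : 0 < θ) (hW : 0 ≤ W) (hJ : 0 ≤ J)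
    (hWJ : 0 < W + J) :
    ∃ q ∈ ({2, 4} : Set ℕ), ∀ (n : ℕ) [NeZero n], 101 ≤ n → HasFlatSequence q n →
      OptimalUpTo (4 / 3) {1 / 4, 1 / 2} θ W J n := by
  have hw0 : 0 ≤ W / (W + J) := by positivity
  have hw1 : W / (W + J) ≤ 1 := by rw [div_le_one hWJ]; linarith
  have est : ∀ n : ℕ, 101 ≤ n → (2 ≤ n ∧ (101 : ℝ) ≤ n) ∧
      (98 / 75 : ℝ) ≤ 4 / 3 * (1 - 1 / n) ^ 2 ∧ 1 + 4 / ((n : ℝ) - 1) ≤ 104 / 100 := by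
    intro n hn
    have hn' : (101 : ℝ) ≤ n := by exact_mod_cast hn
    exact ⟨⟨by omega, hn'⟩,
      length_estimates (N := 101) (by norm_num) (by norm_num) hn' (by norm_num) (by norm_num)⟩
  rcases le_or_gt (W / (W + J)) (1 / 4) with h1 | h1
  · refine ⟨4, by simp, fun n _ hn hf => ?_⟩
    obtain ⟨⟨hn2, hn'⟩, hc, hk⟩ := est n hn
    obtain ⟨a, ha, hρ⟩ := hf.exists_transmissivity (by norm_num)
    refine optimalUpTo_of_isSpectrallyFlat (p := 1 / 4) hθ hW hJ hWJ rfl (by norm_num)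
      (by norm_num) (by norm_num) hn2 hc hk (by linarith) (by simp) ha (by simpa using hρ) ?_ ?_
    · intro ρ r hρ0 hρ1 hcρ hr0 hr1
      refine cross_le_of_endpoint (by norm_num) (by norm_num) hρ0 hρ1 hw0 h1 (by norm_num) hr0 ?_
      refine cross_le_of_slack (by norm_num) (by norm_num) (by norm_num) (by norm_num)
        (by norm_num) hρ0 hρ1 hcρ hr0 hr1 ?_
      nlinarith [sq_nonneg (r - 3 / 10)]
    · exact fun r hr0 hr1 => poly_le_quarter' hr0 hw0 h1
  · refine ⟨2, by simp, fun n _ hn hf => ?_⟩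
    obtain ⟨⟨hn2, hn'⟩, hc, hk⟩ := est n hn
    obtain ⟨a, ha, hρ⟩ := hf.exists_transmissivity (by norm_num)
    refine optimalUpTo_of_isSpectrallyFlat (p := 1 / 2) hθ hW hJ hWJ rfl (by norm_num)
      (by norm_num) (by norm_num) hn2 hc hk (by linarith) (by simp) ha (by simpa using hρ) ?_ ?_
    · intro ρ r hρ0 hρ1 hcρ hr0 hr1
      refine cross_le_of_slack (by norm_num) (by norm_num) (by norm_num) hw0 hw1
        hρ0 hρ1 hcρ hr0 hr1 ?_
      generalize W / (W + J) = w at *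
      nlinarith [mul_nonneg (sub_nonneg.2 h1.le) (sq_nonneg (r - 1 / 2)),
        mul_nonneg (sub_nonneg.2 hw1) (sq_nonneg (r - 3 / 10))]
    · exact fun r hr0 hr1 => poly_le_half' hr0 h1.le hw1

/-! ### Gauss sums and Singer difference sets -/

lemma norm_sq_gaussSum {F : Type*} [Field F] [Fintype F] {χ : MulChar F ℂ} (hχ : χ ≠ 1)
    {ψ : AddChar F ℂ} (hψ : ψ.IsPrimitive) : ‖gaussSum χ ψ‖ ^ 2 = Fintype.card F := by
  have h := gaussSum_mul_gaussSum_eq_card hχ hψ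
  rw [← star_gaussSum_eq] at h
  have h2 : ((‖gaussSum χ ψ‖ ^ 2 : ℝ) : ℂ) = (Fintype.card F : ℂ) := by
    rw [← h, ← Complex.normSq_eq_norm_sq, ← Complex.mul_conj]; rfl
  exact_mod_cast h2

lemma sum_eq_zero_add_sum_units {F : Type*} [Field F] [Fintype F] [Fintype Fˣ] (f : F → ℂ) :
    ∑ x, f x = f 0 + ∑ u : Fˣ, f u := by
  classical
  rw [← Finset.add_sum_erase _ _ (Finset.mem_univ (0 : F))]
  congr 1
  symm
  refine Finset.sum_bij (fun u _ => (u : F)) (fun u _ => by simp) (fun u _ v _ h => Units.ext h)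
    (fun x hx => ⟨Units.mk0 x (Finset.ne_of_mem_erase hx), Finset.mem_univ _, rfl⟩)
    (fun u _ => rfl)

lemma sum_stdAddChar_mul_eq_zero {n : ℕ} [NeZero n] {k : ZMod n} (hk : k ≠ 0) :
    ∑ i : ZMod n, ZMod.stdAddChar (-(i * k)) = (0 : ℂ) := by
  have h := AddChar.sum_mulShift (-k) (ZMod.isPrimitive_stdAddChar n)
  rw [if_neg (neg_ne_zero.2 hk)] at h
  simpa using h

lemma card_units_eq_sub_one (F : Type*) [Field F] [Fintype F] [Fintype Fˣ] :
    Fintype.card Fˣ = Fintype.card F - 1 := by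
  rw [← Nat.card_eq_fintype_card, Nat.card_units, Nat.card_eq_fintype_card]

section Singer

variable {K L : Type*} [Field K] [Fintype K] [Field L] [Algebra K L]

/-- The coset representatives `g ^ i`, for `i` modulo the index `n` of `Kˣ` in the cyclic group
`Lˣ` generated by `g`. -/
lemma bijective_units_mul_pow [Fintype L] {n : ℕ} [NeZero n] [Fintype Lˣ] [Fintype Kˣ]
    (hn : n * (Fintype.card K - 1) = Fintype.card L - 1) {g : Lˣ}
    (hg : ∀ x, x ∈ Subgroup.zpowers g) :
    Function.Bijective fun x : ZMod n × Kˣ => Units.map (algebraMap K L : K →* L) x.2 *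
      g ^ x.1.val := by
  classical
  have hord : orderOf g = n * (Fintype.card K - 1) := by
    rw [hn, orderOf_eq_card_of_forall_mem_zpowers hg, Nat.card_eq_fintype_card,
      card_units_eq_sub_one L]
  have hcard : Fintype.card Kˣ = Fintype.card K - 1 := card_units_eq_sub_one K
  have hpos : 0 < Fintype.card K - 1 := hcard ▸ Fintype.card_pos
  rw [Fintype.bijective_iff_injective_and_card]
  refine ⟨?_, ?_⟩
  · rintro ⟨i, c⟩ ⟨j, d⟩ h
    simp only at h
    have h2 := congrArg (· ^ (Fintype.card K - 1)) h
    simp only [mul_pow, ← map_pow, ← hcard, pow_card_eq_one, map_one, one_mul] at h2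
    rw [← pow_mul, ← pow_mul, pow_inj_mod, hcard, hord, Nat.mul_mod_mul_right,
      Nat.mul_mod_mul_right, Nat.mod_eq_of_lt (ZMod.val_lt i), Nat.mod_eq_of_lt (ZMod.val_lt j)]
      at h2
    have hij : i = j := ZMod.val_injective n (Nat.eq_of_mul_eq_mul_right hpos h2)
    subst hij
    have h3 : c = d :=
      Units.map_injective (algebraMap K L).injective (mul_right_cancel h)
    rw [h3]
  · rw [Fintype.card_prod, ZMod.card, hcard, hn, card_units_eq_sub_one L]

/-- A character of the cyclic group `Lˣ / Kˣ` of order `n`, with a prescribed value at the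
generator. -/
lemma exists_mulChar_apply_eq [Fintype L] {n : ℕ} [NeZero n]
    (hn : n * (Fintype.card K - 1) = Fintype.card L - 1) {g : Lˣ}
    (hg : ∀ x, x ∈ Subgroup.zpowers g) {z : ℂ} (hz : z ^ n = 1) :
    ∃ χ : MulChar L ℂ, χ g = z ∧ ∀ c : Kˣ, χ (algebraMap K L c) = 1 := by
  classical
  have hz0 : z ≠ 0 := by
    rintro rfl
    rw [zero_pow (NeZero.ne n)] at hz
    exact zero_ne_one hz
  have hord : orderOf g = n * (Fintype.card K - 1) := by
    rw [hn, orderOf_eq_card_of_forall_mem_zpowers hg, Nat.card_eq_fintype_card,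
      card_units_eq_sub_one L]
  have hcard : Fintype.card Kˣ = Fintype.card K - 1 := card_units_eq_sub_one K
  have hpos : 0 < Fintype.card K - 1 := hcard ▸ Fintype.card_pos
  have hroot : Units.mk0 z hz0 ∈ rootsOfUnity (Fintype.card Lˣ) ℂ := by
    rw [mem_rootsOfUnity, Units.ext_iff, Units.val_pow_eq_pow_val, Units.val_mk0,
      card_units_eq_sub_one L, ← hn, pow_mul, hz, one_pow, Units.val_one]
  refine ⟨MulChar.ofRootOfUnity hroot hg, MulChar.ofRootOfUnity_spec hroot hg, fun c => ?_⟩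
  obtain ⟨j, hj⟩ := (mem_powers_iff_mem_zpowers (x := g)).2
    (hg (Units.map (algebraMap K L : K →* L) c))
  simp only at hj
  have h1 : g ^ (j * (Fintype.card K - 1)) = 1 := by
    rw [pow_mul, hj, ← map_pow, ← hcard, pow_card_eq_one, map_one]
  rw [← orderOf_dvd_iff_pow_eq_one, hord] at h1
  obtain ⟨l, rfl⟩ := Nat.dvd_of_mul_dvd_mul_right hpos h1
  have h2 : algebraMap K L c = ((g ^ (n * l) : Lˣ) : L) := by rw [hj]; rfl
  rw [h2, Units.val_pow_eq_pow_val, map_pow, MulChar.ofRootOfUnity_spec hroot hg, pow_mul,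
    Units.val_mk0, hz, one_pow]

/-- Orthogonality of characters on the `K`-line through `x`, without its origin. -/
lemma sum_units_addChar_mul [Fintype Kˣ] (ψ : AddChar L ℂ) (x : L)
    [Decidable (∀ c : K, ψ (algebraMap K L c * x) = 1)] :
    ∑ c : Kˣ, ψ (algebraMap K L c * x) =
      Fintype.card K * (if ∀ c : K, ψ (algebraMap K L c * x) = 1 then 1 else 0) - 1 := by
  classical
  let φ : AddChar K ℂ :=
    ψ.compAddMonoidHom ((AddMonoidHom.mulRight x).comp (algebraMap K L).toAddMonoidHom)
  have hφ : ∀ c : K, φ c = ψ (algebraMap K L c * x) := fun c => rfl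
  have h := AddChar.sum_eq_ite φ
  rw [sum_eq_zero_add_sum_units, AddChar.map_zero_eq_one] at h
  simp only [hφ] at h
  have h0 : φ = 0 ↔ ∀ c : K, ψ (algebraMap K L c * x) = 1 := by
    rw [AddChar.eq_zero_iff]; rfl
  rw [eq_sub_iff_add_eq, add_comm, h]
  by_cases hx : ∀ c : K, ψ (algebraMap K L c * x) = 1
  · rw [if_pos (h0.2 hx), if_pos hx, mul_one]
  · rw [if_neg (mt h0.1 hx), if_neg hx, mul_zero]

/-- **Singer difference sets.** Identify `ℤ/n` with `Lˣ / Kˣ`. The indicator sequence of a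
hyperplane of the projective space `Lˣ / Kˣ` is spectrally flat, since up to the factor `|K|` its
Fourier coefficients are the Gauss sums of the characters of `Lˣ` that are trivial on `Kˣ`. The
hyperplane is the largest `K`-subspace of the kernel of a primitive additive character. -/
theorem hasFlatSequence_singer [Fintype L] {n : ℕ} [NeZero n]
    (hn : n * (Fintype.card K - 1) = Fintype.card L - 1) :
    HasFlatSequence (Fintype.card K) n := by
  classical
  obtain ⟨g, hg⟩ := IsCyclic.exists_generator (α := Lˣ)
  obtain ⟨ψ, hψ⟩ : ∃ ψ : AddChar L ℂ, ψ.IsPrimitive :=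
    ⟨_, AddChar.FiniteField.primitiveChar_to_Complex_isPrimitive L⟩
  let a : ZMod n → ℝ := fun i =>
    if ∀ c : K, ψ (algebraMap K L c * (g ^ i.val : Lˣ)) = 1 then 1 else 0
  have hsum : ∀ F : L → ℂ, ∑ u : Lˣ, F u =
      ∑ i : ZMod n, ∑ c : Kˣ, F (algebraMap K L c * (g ^ i.val : Lˣ)) := by
    intro F
    rw [← (bijective_units_mul_pow hn hg).sum_comp (fun u : Lˣ => F u), Fintype.sum_prod_type]
    rfl
  have hinner : ∀ i : ZMod n, ∑ c : Kˣ, ψ (algebraMap K L c * (g ^ i.val : Lˣ)) =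
      Fintype.card K * (a i : ℂ) - 1 := by
    intro i
    rw [sum_units_addChar_mul]
    simp only [a, apply_ite Complex.ofReal, Complex.ofReal_one, Complex.ofReal_zero]
  have hψ1 : ψ ≠ 1 := by
    have := hψ (one_ne_zero)
    rwa [AddChar.mulShift_one] at this
  have hGauss : ∀ k : ZMod n, k ≠ 0 →
      ‖(Fintype.card K : ℂ) * apertureDFT a k‖ ^ 2 = Fintype.card L := by
    intro k hk
    have hz : (ZMod.stdAddChar (-k) : ℂ) ^ n = 1 := by
      rw [← AddChar.map_nsmul_eq_pow, nsmul_eq_mul, CharP.cast_eq_zero, zero_mul,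
        AddChar.map_zero_eq_one]
    obtain ⟨χ, hχg, hχK⟩ := exists_mulChar_apply_eq hn hg hz
    have hχ : χ ≠ 1 := by
      rintro rfl
      rw [MulChar.one_apply_coe] at hχg
      have h0 : (ZMod.stdAddChar (-k) : ℂ) = ZMod.stdAddChar (0 : ZMod n) := by
        rw [← hχg, AddChar.map_zero_eq_one]
      exact hk (neg_eq_zero.1 (ZMod.injective_stdAddChar h0))
    rw [← norm_sq_gaussSum hχ hψ]
    congr 2
    symm
    calc gaussSum χ ψ = ∑ u : Lˣ, χ u * ψ u := by
          rw [gaussSum, sum_eq_zero_add_sum_units, MulChar.map_zero, zero_mul, zero_add]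
      _ = ∑ i : ZMod n, ∑ c : Kˣ, χ (algebraMap K L c * (g ^ i.val : Lˣ)) *
            ψ (algebraMap K L c * (g ^ i.val : Lˣ)) := hsum fun x => χ x * ψ x
      _ = ∑ i : ZMod n, ZMod.stdAddChar (-(i * k)) * (Fintype.card K * (a i : ℂ) - 1) := by
          refine Finset.sum_congr rfl fun i _ => ?_
          rw [← hinner, Finset.mul_sum]
          refine Finset.sum_congr rfl fun c _ => ?_
          rw [map_mul, hχK, one_mul, Units.val_pow_eq_pow_val, map_pow, hχg,
            ← AddChar.map_nsmul_eq_pow, nsmul_eq_mul, ZMod.natCast_zmod_val, mul_neg]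
      _ = Fintype.card K * apertureDFT a k := by
          simp only [mul_sub, mul_one]
          rw [Finset.sum_sub_distrib, sum_stdAddChar_mul_eq_zero hk, sub_zero, apertureDFT,
            ZMod.dft_apply, Finset.mul_sum]
          refine Finset.sum_congr rfl fun i _ => ?_
          rw [smul_eq_mul]; ring
  refine ⟨a, ⟨fun i => ?_, fun i j hi hj => ?_⟩, ?_⟩
  · simp only [a]
    split_ifs <;> simp
  · have h := (hGauss i hi).trans (hGauss j hj).symm
    rw [norm_mul, norm_mul, mul_pow, mul_pow] at h
    have hK : ‖(Fintype.card K : ℂ)‖ ^ 2 ≠ 0 := by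
      rw [Complex.norm_natCast]
      exact_mod_cast pow_ne_zero 2 Fintype.card_ne_zero
    exact (pow_left_inj₀ (norm_nonneg _) (norm_nonneg _) two_ne_zero).1
      (mul_left_cancel₀ hK h)
  · have h : ∑ u : Lˣ, ψ u = -1 := by
      have := sum_eq_zero_add_sum_units ψ
      rw [AddChar.sum_eq_zero_of_ne_one hψ1, AddChar.map_zero_eq_one] at this
      linear_combination -this
    rw [hsum] at h
    simp only [hinner] at h
    rw [Finset.sum_sub_distrib, ← Finset.mul_sum, Finset.sum_const, Finset.card_univ, ZMod.card,
      nsmul_eq_mul, mul_one] at h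
    have h2 : (((Fintype.card K * ∑ i, a i : ℝ)) : ℂ) = ((n - 1 : ℝ) : ℂ) := by
      push_cast
      linear_combination h
    exact_mod_cast h2

end Singer

lemma exists_hasFlatSequence_of_card (K L : Type*) [Field K] [Finite K] [Field L] [Algebra K L]
    {q : ℕ} (hq : 2 ≤ q) (hK : Nat.card K = q) (hL : Nat.card L = q ^ 31) :
    ∃ n : ℕ, 10 ^ 9 < n ∧ ∃ _ : NeZero n, HasFlatSequence q n := by
  have : Finite L := Nat.finite_of_card_ne_zero (by rw [hL]; positivity)
  have := Fintype.ofFinite K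
  have := Fintype.ofFinite L
  rw [Nat.card_eq_fintype_card] at hK hL
  have hn : (∑ i ∈ Finset.range 31, q ^ i) * (q - 1) = q ^ 31 - 1 := by
    rw [Nat.geomSum_eq hq 31]
    refine Nat.div_mul_cancel ?_
    simpa using Nat.sub_dvd_pow_sub_pow q 1 31
  have hlarge : 10 ^ 9 < ∑ i ∈ Finset.range 31, q ^ i := by
    calc 10 ^ 9 < ∑ i ∈ Finset.range 31, 2 ^ i := by
          rw [Nat.geomSum_eq le_rfl]; norm_num
      _ ≤ _ := Finset.sum_le_sum fun i _ => Nat.pow_le_pow_left hq i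
  generalize ∑ i ∈ Finset.range 31, q ^ i = n at *
  have hn0 : NeZero n := ⟨by omega⟩
  refine ⟨n, hlarge, hn0, ?_⟩
  rw [← hL] at hn
  subst hK
  exact hasFlatSequence_singer hn

/-- Singer difference sets with the density `1 / q` for a prime power `q = 2 ^ e`. -/
lemma exists_hasFlatSequence_two_pow {e : ℕ} (he : e ≠ 0) :
    ∃ n : ℕ, 10 ^ 9 < n ∧ ∃ _ : NeZero n, HasFlatSequence (2 ^ e) n := by
  have hK : Nat.card (GaloisField 2 e) = 2 ^ e := GaloisField.card 2 e he
  have hfin : Finite (GaloisField 2 e) := Nat.finite_of_card_ne_zero (by rw [hK]; positivity)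
  exact exists_hasFlatSequence_of_card (GaloisField 2 e)
    (FiniteField.Extension (GaloisField 2 e) 2 31) (Nat.le_self_pow he 2) hK
    (by rw [FiniteField.natCard_extension, hK])

/-! ### Residue sequences of prime length -/

/-- The indicator sequence of the kernel of a multiplicative character modulo `p`; for a character
of order `q` these are the `q`-th power residues. -/
noncomputable def residueSequence {p : ℕ} (χ : MulChar (ZMod p) ℂ) : ZMod p → ℝ :=
  open Classical in fun i => if χ i = 1 then 1 else 0

section Residues

variable {p : ℕ} [Fact p.Prime] {χ : MulChar (ZMod p) ℂ}

lemma orderOf_mul_residueSequence (χ : MulChar (ZMod p) ℂ) (i : ZMod p) :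
    (orderOf χ : ℂ) * residueSequence χ i = ∑ j ∈ Finset.range (orderOf χ), (χ ^ j) i := by
  classical
  rcases eq_or_ne i 0 with rfl | hi
  · rw [Finset.sum_eq_zero fun j _ => MulChar.map_zero _, residueSequence, MulChar.map_zero,
      if_neg zero_ne_one, Complex.ofReal_zero, mul_zero]
  obtain ⟨u, rfl⟩ := hi.isUnit
  have hpow : χ u ^ orderOf χ = 1 := by
    rw [← MulChar.pow_apply_coe, pow_orderOf_eq_one, MulChar.one_apply_coe]
  simp only [MulChar.pow_apply_coe, residueSequence]
  split_ifs with h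
  · simp [h]
  · have h2 := mul_geom_sum (χ u) (orderOf χ)
    rw [hpow, sub_self] at h2
    rw [(mul_eq_zero.1 h2).resolve_left (sub_ne_zero.2 h)]
    simp

lemma orderOf_mul_sum_residueSequence [NeZero p] (χ : MulChar (ZMod p) ℂ) :
    (orderOf χ : ℝ) * ∑ i, residueSequence χ i = p - 1 := by
  classical
  have hpos : 0 < orderOf χ := χ.orderOf_pos
  have h : ((orderOf χ * ∑ i, residueSequence χ i : ℝ) : ℂ) = ((p - 1 : ℝ) : ℂ) := by
    push_cast
    rw [Finset.mul_sum]
    simp only [orderOf_mul_residueSequence]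
    rw [Finset.sum_comm, ← Finset.add_sum_erase _ _ (Finset.mem_range.2 hpos), pow_zero,
      MulChar.sum_one_eq_card_units, Finset.sum_eq_zero]
    · rw [ZMod.card_units, Nat.cast_sub (Fact.out : p.Prime).one_le, Nat.cast_one, add_zero]
    · intro j hj
      refine MulChar.sum_eq_zero_of_ne_one (pow_ne_one_of_lt_orderOf ?_ ?_)
      · exact Finset.ne_of_mem_erase hj
      · exact Finset.mem_range.1 (Finset.mem_of_mem_erase hj)
  exact_mod_cast h

/-- The Fourier transform of a residue sequence (the Gaussian periods) in terms of Gauss sums. -/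
lemma orderOf_mul_apertureDFT_residueSequence [NeZero p] (χ : MulChar (ZMod p) ℂ) {k : ZMod p}
    (hk : k ≠ 0) : ∃ c : ℂ, c ^ orderOf χ = 1 ∧
      (orderOf χ : ℂ) * apertureDFT (residueSequence χ) k =
        ∑ j ∈ Finset.range (orderOf χ), c ^ j * gaussSum (χ ^ j) ZMod.stdAddChar := by
  obtain ⟨u, hu⟩ := (neg_ne_zero.2 hk).isUnit
  refine ⟨χ⁻¹ u, ?_, ?_⟩
  · rw [← MulChar.pow_apply_coe, inv_pow, pow_orderOf_eq_one, inv_one, MulChar.one_apply_coe]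
  · rw [apertureDFT, ZMod.dft_apply, Finset.mul_sum]
    calc ∑ i, (orderOf χ : ℂ) * (ZMod.stdAddChar (-(i * k)) • (residueSequence χ i : ℂ))
        = ∑ i, ∑ j ∈ Finset.range (orderOf χ), (χ ^ j) i * ZMod.stdAddChar (-(i * k)) := by
          refine Finset.sum_congr rfl fun i _ => ?_
          rw [smul_eq_mul, mul_left_comm, orderOf_mul_residueSequence, Finset.mul_sum]
          exact Finset.sum_congr rfl fun j _ => mul_comm _ _
      _ = ∑ j ∈ Finset.range (orderOf χ), (χ⁻¹ u) ^ j * gaussSum (χ ^ j) ZMod.stdAddChar := by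
          rw [Finset.sum_comm]
          refine Finset.sum_congr rfl fun j _ => ?_
          have h := gaussSum_mulShift_eq (χ ^ j) ZMod.stdAddChar u
          rw [← inv_pow, MulChar.pow_apply_coe] at h
          rw [← h, gaussSum]
          refine Finset.sum_congr rfl fun i _ => ?_
          rw [AddChar.mulShift_apply, hu, neg_mul, mul_comm k]

/-- A residue sequence is spectrally flat if its Gaussian periods have a constant modulus. -/
lemma hasFlatSequence_of_residueSequence [NeZero p] {q : ℕ} (hq : orderOf χ = q) {B : ℝ}
    (h : ∀ c : ℂ, c ^ q = 1 →
      ‖∑ j ∈ Finset.range q, c ^ j * gaussSum (χ ^ j) ZMod.stdAddChar‖ ^ 2 = B) :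
    HasFlatSequence q p := by
  subst hq
  have hpos : 0 < orderOf χ := χ.orderOf_pos
  refine ⟨residueSequence χ, ⟨fun i => ?_, fun i j hi hj => ?_⟩,
    orderOf_mul_sum_residueSequence χ⟩
  · rw [residueSequence]
    split_ifs <;> simp
  · have key : ∀ k : ZMod p, k ≠ 0 →
        ‖(orderOf χ : ℂ)‖ ^ 2 * ‖apertureDFT (residueSequence χ) k‖ ^ 2 = B := by
      intro k hk
      obtain ⟨c, hc, he⟩ := orderOf_mul_apertureDFT_residueSequence χ hk
      rw [← mul_pow, ← norm_mul, he, h c hc]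
    have hK : ‖(orderOf χ : ℂ)‖ ^ 2 ≠ 0 := by
      rw [Complex.norm_natCast]
      exact_mod_cast pow_ne_zero 2 hpos.ne'
    exact (pow_left_inj₀ (norm_nonneg _) (norm_nonneg _) two_ne_zero).1
      (mul_left_cancel₀ hK ((key i hi).trans (key j hj).symm))

lemma apply_pow_orderOf {x : ZMod p} (hx : x ≠ 0) : χ x ^ orderOf χ = 1 := by
  obtain ⟨u, rfl⟩ := hx.isUnit
  rw [← MulChar.pow_apply_coe, pow_orderOf_eq_one, MulChar.one_apply_coe]

/-- A character is odd if its order `2 m` contains the full power of `2` in `p - 1`: if `χ u ^ m` is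
not `1`, it is `-1`, hence `χ (u ^ ((p - 1) / 2)) = -1` and `u ^ ((p - 1) / 2)` is not `1`. -/
lemma apply_neg_one_of_orderOf {m f : ℕ} (hm : m ≠ 0) (hχ : orderOf χ = 2 * m) (hf : Odd f)
    (hp : p / 2 = m * f) : χ (-1) = -1 := by
  have h1 : χ ^ m ≠ 1 := pow_ne_one_of_lt_orderOf hm (by omega)
  obtain ⟨u, hu⟩ := MulChar.ne_one_iff.1 h1
  rw [MulChar.pow_apply_coe] at hu
  have hu2 : χ u ^ m = -1 := by
    have h := apply_pow_orderOf (χ := χ) u.ne_zero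
    rw [hχ, mul_comm, pow_mul] at h
    exact (sq_eq_one_iff.1 h).resolve_left hu
  have h3 : χ ((u : ZMod p) ^ (p / 2)) = -1 := by
    rw [map_pow, hp, pow_mul, hu2, hf.neg_one_pow]
  rcases ZMod.pow_div_two_eq_neg_one_or_one p u.ne_zero with h | h
  · rw [h, map_one] at h3
    norm_num at h3
  · rwa [h] at h3

lemma stdAddChar_ne_one [NeZero p] : (ZMod.stdAddChar : AddChar (ZMod p) ℂ) ≠ 1 := by
  have := ZMod.isPrimitive_stdAddChar p one_ne_zero
  rwa [AddChar.mulShift_one] at this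

end Residues

lemma exists_mulChar_zmod_orderOf {p q : ℕ} [Fact p.Prime] (h : q ∣ p - 1) {z : ℂ}
    (hz : IsPrimitiveRoot z q) : ∃ χ : MulChar (ZMod p) ℂ, orderOf χ = q :=
  MulChar.exists_mulChar_orderOf (ZMod p) (by rwa [ZMod.card]) hz

/-- **Paley difference sets**: for `p ≡ 3 (mod 4)` the quadratic Gauss sum is purely imaginary. -/
theorem hasFlatSequence_paley {p : ℕ} [NeZero p] (hp : p.Prime) (hp4 : p % 4 = 3) :
    HasFlatSequence 2 p := by
  have := Fact.mk hp
  obtain ⟨χ, hχ⟩ := exists_mulChar_zmod_orderOf (p := p) (q := 2) (by omega)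
    (IsPrimitiveRoot.neg_one 0 two_ne_zero.symm)
  have hneg : χ (-1) = -1 :=
    apply_neg_one_of_orderOf (m := 1) (f := p / 2) one_ne_zero hχ
      (by rw [Nat.odd_iff]; omega) (one_mul _).symm
  have hsq : χ ^ 2 = 1 := hχ ▸ pow_orderOf_eq_one χ
  have hne : χ ≠ 1 := by
    rintro rfl
    simp at hχ
  have hG := gaussSum_sq hne (MulChar.isQuadratic_iff_sq_eq_one.2 hsq)
    (ZMod.isPrimitive_stdAddChar p)
  rw [hneg, ZMod.card] at hG
  refine hasFlatSequence_of_residueSequence hχ (B := 1 + p) fun c hc => ?_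
  rw [Finset.sum_range_succ, Finset.sum_range_one, pow_zero, pow_zero, one_mul, pow_one, pow_one,
    gaussSum_one_left stdAddChar_ne_one]
  have hz : (c * gaussSum χ ZMod.stdAddChar) ^ 2 = -(p : ℂ) := by
    rw [mul_pow, hc, hG]; ring
  generalize c * gaussSum χ ZMod.stdAddChar = z at hz
  have hp0 : (0 : ℝ) < p := by exact_mod_cast hp.pos
  have hre : z.re * z.re - z.im * z.im = -p := by
    have := congrArg Complex.re hz
    simpa [sq] using this
  have him : z.re * z.im = 0 := by
    have := congrArg Complex.im hz
    simp only [sq, Complex.mul_im, Complex.neg_im, Complex.natCast_im, neg_zero] at this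
    linarith
  have h0 : z.re = 0 := by
    rcases mul_eq_zero.1 him with h | h
    · exact h
    · rw [h] at hre
      nlinarith [mul_self_nonneg z.re]
  rw [← Complex.normSq_eq_norm_sq, Complex.normSq_apply]
  simp only [Complex.add_re, Complex.add_im, Complex.neg_re, Complex.neg_im, Complex.one_re,
    Complex.one_im, h0] at hre ⊢
  linarith

/-! ### Quartic residues -/

lemma eq_of_pow_four_eq_one {z : ℂ} (hz : z ^ 4 = 1) :
    z = 1 ∨ z = -1 ∨ z = Complex.I ∨ z = -Complex.I := by
  have h : (z - 1) * ((z + 1) * ((z - Complex.I) * (z + Complex.I))) = 0 := by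
    linear_combination hz + (z ^ 2 - 1) * (-Complex.I_sq)
  rcases mul_eq_zero.1 h with h | h
  · exact Or.inl (sub_eq_zero.1 h)
  rcases mul_eq_zero.1 h with h | h
  · exact Or.inr (Or.inl (eq_neg_of_add_eq_zero_left h))
  rcases mul_eq_zero.1 h with h | h
  · exact Or.inr (Or.inr (Or.inl (sub_eq_zero.1 h)))
  · exact Or.inr (Or.inr (Or.inr (eq_neg_of_add_eq_zero_left h)))

/-- The numbers of times that a function with values in `{0, 1, -1, i, -i}` takes these values
determine its sum and the sum of its squares. -/
lemma sum_eq_of_values {ι : Type*} [Fintype ι] {f : ι → ℂ} (hf : ∀ t, f t = 0 ∨ f t ^ 4 = 1) :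
    ∃ a b c d e : ℕ, a = (Finset.univ.filter fun t => f t = 0).card ∧
      c = (Finset.univ.filter fun t => f t = -1).card ∧
      a + b + c + d + e = Fintype.card ι ∧ ∑ t, f t = (b - c : ℂ) + (d - e : ℂ) * Complex.I ∧
      ∑ t, f t ^ 2 = (b + c - d - e : ℂ) := by
  classical
  have h1 : (1 : ℂ) ≠ -1 := by norm_num
  have h2 : (1 : ℂ) ≠ Complex.I := fun h => by simpa using congrArg Complex.re h
  have h3 : (1 : ℂ) ≠ -Complex.I := fun h => by simpa using congrArg Complex.re h
  have h4 : (-1 : ℂ) ≠ Complex.I := fun h => by simpa using congrArg Complex.re h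
  have h5 : (-1 : ℂ) ≠ -Complex.I := fun h => by simpa using congrArg Complex.re h
  have h6 : Complex.I ≠ -Complex.I := fun h => by
    have := congrArg Complex.im h
    norm_num at this
  have hI := Complex.I_ne_zero
  have hval : ∀ t, f t = 0 ∨ f t = 1 ∨ f t = -1 ∨ f t = Complex.I ∨ f t = -Complex.I := fun t =>
    (hf t).imp id eq_of_pow_four_eq_one
  refine ⟨_, (Finset.univ.filter fun t => f t = 1).card, _,
    (Finset.univ.filter fun t => f t = Complex.I).card,
    (Finset.univ.filter fun t => f t = -Complex.I).card, rfl, rfl, ?_, ?_, ?_⟩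
  · simp only [Finset.card_filter, ← Finset.sum_add_distrib]
    rw [← Finset.card_univ, Finset.card_eq_sum_ones]
    refine Finset.sum_congr rfl fun t _ => ?_
    rcases hval t with h | h | h | h | h <;> rw [h] <;>
      simp [h1, h1.symm, h2, h2.symm, h3, h3.symm, h4, h4.symm, h5, h5.symm, h6, h6.symm, hI,
        hI.symm]
  · simp only [Finset.card_filter, Nat.cast_sum, ← Finset.sum_sub_distrib, Finset.sum_mul,
      ← Finset.sum_add_distrib]
    refine Finset.sum_congr rfl fun t _ => ?_
    rcases hval t with h | h | h | h | h <;> rw [h] <;>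
      simp [h1, h1.symm, h2, h2.symm, h3, h3.symm, h4, h4.symm, h5, h5.symm, h6, h6.symm, hI,
        hI.symm]
  · simp only [Finset.card_filter, Nat.cast_sum, ← Finset.sum_sub_distrib,
      ← Finset.sum_add_distrib]
    refine Finset.sum_congr rfl fun t _ => ?_
    rcases hval t with h | h | h | h | h <;> rw [h] <;>
      simp [h1, h1.symm, h2, h2.symm, h3, h3.symm, h4, h4.symm, h5, h5.symm, h6, h6.symm, hI,
        hI.symm]

/-- The representation of a prime as a sum of two squares is unique; here for `1 + y²`. -/
lemma sq_eq_one_of_sq_add_sq {p : ℕ} (hp : p.Prime) {a b y : ℤ} (ha : a % 2 = 1)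
    (hy : y % 2 = 0) (h1 : (p : ℤ) = 1 + y ^ 2) (h2 : a ^ 2 + b ^ 2 = p) : a ^ 2 = 1 := by
  have hpZ : Prime (p : ℤ) := Nat.prime_iff_prime_int.1 hp
  have hp0 : (0 : ℤ) < p := by exact_mod_cast hp.pos
  have hdvd : (p : ℤ) ∣ (a * y - b) * (a * y + b) :=
    ⟨a ^ 2 - 1, by linear_combination (-(a ^ 2)) * h1 - h2⟩
  -- up to the sign of `b`
  have key : ∀ b : ℤ, a ^ 2 + b ^ 2 = p → (p : ℤ) ∣ a * y - b → a ^ 2 = 1 := by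
    intro b h2 ⟨m, hm⟩
    have hsum : (a * y - b) ^ 2 + (a + b * y) ^ 2 = p ^ 2 := by
      linear_combination (1 + y ^ 2) * h2 - (p : ℤ) * h1
    have hm1 : m ^ 2 ≤ 1 := by
      rw [hm] at hsum
      by_contra hcon
      push Not at hcon
      nlinarith [sq_nonneg (a + b * y), mul_pos hp0 hp0]
    have hcases : m = 0 ∨ m ^ 2 = 1 := by
      have := sq_nonneg m
      rcases (by omega : m ^ 2 = 0 ∨ m ^ 2 = 1) with h | h
      · exact Or.inl (by simpa using h)
      · exact Or.inr h
    rcases hcases with h | h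
    · have hb : b = a * y := by rw [h] at hm; linarith
      have h3 : (a ^ 2 - 1) * (p : ℤ) = 0 := by
        rw [hb] at h2
        linear_combination a ^ 2 * h1 + h2
      rcases mul_eq_zero.1 h3 with h4 | h4
      · linarith
      · exact absurd h4 hp0.ne'
    · -- here `a = - b y` would be even
      have h3 : (a + b * y) ^ 2 = 0 := by
        rw [hm, mul_pow, h] at hsum
        linarith
      have h4 : a = -(b * y) := by
        have := pow_eq_zero_iff (two_ne_zero) |>.1 h3
        linarith
      have h5 : a % 2 = 0 := by
        rw [h4, Int.neg_emod_two, Int.mul_emod, hy]; simp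
      omega
  rcases hpZ.dvd_or_dvd hdvd with h | h
  · exact key b h2 h
  · exact key (-b) (by rwa [neg_sq]) (by rwa [sub_neg_eq_add])

section Quartic

variable {p : ℕ} [Fact p.Prime] {χ : MulChar (ZMod p) ℂ}

/-- The number of solutions of `χ (t (1 - t)) = -1` is odd: the involution `t ↦ 1 - t` has a single
fixed point, which is a solution because `χ 4 = -1`. -/
lemma odd_card_filter_eq_neg_one (hp : p % 8 = 5) (hχ : orderOf χ = 4) (hneg : χ (-1) = -1)
    [DecidablePred fun t : ZMod p => χ t * χ (1 - t) = -1] :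
    Odd (Finset.univ.filter fun t : ZMod p => χ t * χ (1 - t) = -1).card := by
  classical
  have hp2 : p ≠ 2 := by omega
  have h20 : (2 : ZMod p) ≠ 0 := by
    intro h
    have h' : ((2 : ℕ) : ZMod p) = 0 := by exact_mod_cast h
    rw [ZMod.natCast_eq_zero_iff] at h'
    have := Nat.le_of_dvd (by norm_num) h'
    omega
  have hnsq : ¬ IsSquare (2 : ZMod p) := by
    rw [ZMod.exists_sq_eq_two_iff hp2]; omega
  have hpow : (2 : ZMod p) ^ (p / 2) = -1 :=
    (ZMod.pow_div_two_eq_neg_one_or_one p h20).resolve_left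
      (mt (ZMod.euler_criterion p h20).2 hnsq)
  have h24 : χ 2 ^ 4 = 1 := hχ ▸ apply_pow_orderOf (χ := χ) h20
  have h2 : χ 2 ^ 2 = -1 := by
    rw [← hneg, ← hpow, map_pow, show p / 2 = 4 * (p / 8) + 2 by omega, pow_add, pow_mul, h24,
      one_pow, one_mul]
  have hhalf : χ 2⁻¹ * χ (1 - 2⁻¹) = -1 := by
    have e : (1 : ZMod p) - 2⁻¹ = 2⁻¹ := by field_simp; ring
    have h3 : χ 2 * χ 2⁻¹ = 1 := by rw [← map_mul, mul_inv_cancel₀ h20, map_one]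
    rw [e]
    have h4 : χ 2 ^ 2 * (χ 2⁻¹ * χ 2⁻¹) = 1 := by
      calc _ = (χ 2 * χ 2⁻¹) ^ 2 := by ring
        _ = 1 := by rw [h3, one_pow]
    rw [h2] at h4
    linear_combination -h4
  set S := Finset.univ.filter fun t : ZMod p => χ t * χ (1 - t) = -1 with hS
  have hmem : (2⁻¹ : ZMod p) ∈ S := by simpa [hS] using hhalf
  have hzero : ∑ _t ∈ S.erase 2⁻¹, (1 : ZMod 2) = 0 := by
    refine Finset.sum_involution (fun t _ => 1 - t) (fun _ _ => by decide) ?_ ?_ ?_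
    · intro t ht _ he
      refine Finset.ne_of_mem_erase ht ?_
      exact eq_inv_of_mul_eq_one_left (by linear_combination -he)
    · intro t ht
      obtain ⟨h5, h6⟩ := Finset.mem_erase.1 ht
      refine Finset.mem_erase.2 ⟨fun h7 => h5 ?_, ?_⟩
      · have : t = 1 - 2⁻¹ := by linear_combination -h7
        rw [this]; field_simp; ring
      · simp only [hS, Finset.mem_filter, Finset.mem_univ, true_and] at h6 ⊢
        rw [sub_sub_cancel, mul_comm, h6]
    · intro t _
      exact sub_sub_cancel 1 t
  rw [Finset.sum_const, nsmul_eq_mul, mul_one, ZMod.natCast_eq_zero_iff_even] at hzero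
  have hcard := Finset.card_erase_add_one hmem
  rw [← hcard]
  exact hzero.add_one

/-- For `p = 1 + y²` with `y / 2` odd the Jacobi sum of a quartic character has real part `-1`. It
is a Gaussian integer of norm `p`, hence equal to `±1 ± y i`, and its real part is `-1` modulo `4`
by a count of the values of `χ (t (1 - t))`. -/
lemma re_jacobiSum_quartic [NeZero p] {y : ℤ} (hp : p % 8 = 5) (hy : (p : ℤ) = 1 + y ^ 2)
    (hχ : orderOf χ = 4) (hneg : χ (-1) = -1) : (jacobiSum χ χ).re = -1 := by
  classical
  have hprime : p.Prime := Fact.out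
  have hχ2 : χ ^ 2 ≠ 1 := pow_ne_one_of_lt_orderOf two_ne_zero (by omega)
  have hχ1 : χ ≠ 1 := fun h => hχ2 (by rw [h, one_pow])
  have hχ4 : (χ ^ 2) ^ 2 = 1 := by
    rw [← pow_mul, show 2 * 2 = orderOf χ by omega, pow_orderOf_eq_one]
  have hf : ∀ t : ZMod p, χ t * χ (1 - t) = 0 ∨ (χ t * χ (1 - t)) ^ 4 = 1 := by
    intro t
    rw [← map_mul]
    rcases eq_or_ne (t * (1 - t)) 0 with h | h
    · left; rw [h, MulChar.map_zero]
    · right; rw [← hχ, apply_pow_orderOf h]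
  obtain ⟨n0, b, c, d, e, hn0, hc, hsum, hJ, hJ2⟩ := sum_eq_of_values hf
  have hzero : n0 = 2 := by
    have : (Finset.univ.filter fun t : ZMod p => χ t * χ (1 - t) = 0) = {0, 1} := by
      ext t
      simp only [Finset.mem_filter, Finset.mem_univ, true_and, Finset.mem_insert,
        Finset.mem_singleton]
      constructor
      · intro h
        by_contra hcon
        push Not at hcon
        have hne : t * (1 - t) ≠ 0 := mul_ne_zero hcon.1 (sub_ne_zero.2 hcon.2.symm)
        have h1 := apply_pow_orderOf (χ := χ) hne
        rw [map_mul, h, hχ] at h1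
        norm_num at h1
      · rintro (rfl | rfl)
        · rw [MulChar.map_zero, zero_mul]
        · rw [sub_self, MulChar.map_zero, mul_zero]
    rw [hn0, this, Finset.card_pair zero_ne_one]
  have hodd : Odd c := hc ▸ odd_card_filter_eq_neg_one hp hχ hneg
  rw [ZMod.card] at hsum
  have hsq : (b + c - d - e : ℂ) = -1 := by
    rw [← hJ2]
    have h := jacobiSum_nontrivial_inv hχ2
    rw [MulChar.isQuadratic_iff_sq_eq_one.2 hχ4 |>.inv, MulChar.pow_apply' χ two_ne_zero, hneg,
      jacobiSum] at h
    simp only [MulChar.pow_apply' χ two_ne_zero] at h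
    simp only [mul_pow]
    rw [h]; norm_num
  have hsqZ : (b : ℤ) + c - d - e = -1 := by exact_mod_cast hsq
  have hJ' : jacobiSum χ χ = ((b : ℤ) - (c : ℤ) : ℤ) + ((d : ℤ) - (e : ℤ) : ℤ) * Complex.I := by
    rw [jacobiSum, hJ]; push_cast; ring
  have hnorm : ‖jacobiSum χ χ‖ ^ 2 = p := by
    have h := jacobiSum_mul_nontrivial (χ := χ) (φ := χ) (by rwa [← sq]) ZMod.stdAddChar
    have h2 := congrArg (fun z => ‖z‖ ^ 2) h
    simp only [norm_mul, mul_pow] at h2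
    have hψ := ZMod.isPrimitive_stdAddChar p
    rw [norm_sq_gaussSum (by rwa [← sq]) hψ, norm_sq_gaussSum hχ1 hψ, ZMod.card] at h2
    exact mul_left_cancel₀ (by exact_mod_cast hprime.ne_zero) h2
  have hnormZ : ((b : ℤ) - c) ^ 2 + ((d : ℤ) - e) ^ 2 = p := by
    rw [hJ', ← Complex.normSq_eq_norm_sq, Complex.normSq_apply] at hnorm
    simp only [Complex.add_re, Complex.add_im, Complex.mul_re, Complex.mul_im, Complex.intCast_re,
      Complex.intCast_im, Complex.I_re, Complex.I_im] at hnorm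
    have h : ((((b : ℤ) - c) ^ 2 + ((d : ℤ) - e) ^ 2 : ℤ) : ℝ) = ((p : ℤ) : ℝ) := by
      push_cast at hnorm ⊢
      linarith
    exact_mod_cast h
  have hyeven : y % 2 = 0 := by
    rcases Int.emod_two_eq_zero_or_one y with h | h
    · exact h
    · have : (1 + y ^ 2) % 2 = 0 := by
        rw [Int.add_emod, pow_two, Int.mul_emod, h]; norm_num
      omega
  obtain ⟨l, hl⟩ := hodd
  have ha : ((b : ℤ) - c) ^ 2 = 1 :=
    sq_eq_one_of_sq_add_sq hprime (by omega) hyeven hy hnormZ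
  have ha' : (b : ℤ) - c = -1 := by
    rcases sq_eq_one_iff.1 ha with h | h <;> omega
  rw [hJ', ha']
  simp

/-- **Quartic residue difference sets**: for a prime `p = 1 + y²` with `y / 2` odd the Gaussian
periods of degree four have constant modulus. -/
theorem hasFlatSequence_quartic [NeZero p] {y : ℤ} (hp : p % 8 = 5) (hy : (p : ℤ) = 1 + y ^ 2) :
    HasFlatSequence 4 p := by
  have hprime : p.Prime := Fact.out
  obtain ⟨χ, hχ⟩ := exists_mulChar_zmod_orderOf (p := p) (q := 4) (by omega)
    Complex.isPrimitiveRoot_I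
  have hneg : χ (-1) = -1 :=
    apply_neg_one_of_orderOf (m := 2) (f := p / 4) two_ne_zero hχ
      (by rw [Nat.odd_iff]; omega) (by omega)
  have hχ2 : χ ^ 2 ≠ 1 := pow_ne_one_of_lt_orderOf two_ne_zero (by omega)
  have hχ1 : χ ≠ 1 := fun h => hχ2 (by rw [h, one_pow])
  have hχ4 : χ ^ 4 = 1 := hχ ▸ pow_orderOf_eq_one χ
  have hinv : χ⁻¹ = χ ^ 3 := by
    rw [inv_eq_iff_mul_eq_one, ← pow_succ', hχ4]
  set ψ : AddChar (ZMod p) ℂ := ZMod.stdAddChar with hψdef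
  have hψ : ψ.IsPrimitive := ZMod.isPrimitive_stdAddChar p
  have hs : gaussSum (χ ^ 2) ψ ^ 2 = p := by
    rw [gaussSum_sq hχ2 (MulChar.isQuadratic_iff_sq_eq_one.2 (by rw [← pow_mul, hχ4])) hψ,
      MulChar.pow_apply' χ two_ne_zero, hneg, ZMod.card]
    norm_num
  have hJ : gaussSum (χ ^ 2) ψ * jacobiSum χ χ = gaussSum χ ψ ^ 2 := by
    have h := jacobiSum_mul_nontrivial (χ := χ) (φ := χ) (by rwa [← sq]) ψ
    rwa [← sq, ← sq] at h
  have hre := re_jacobiSum_quartic hp hy hχ hneg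
  have hG3 : gaussSum (χ ^ 3) ψ = -conj (gaussSum χ ψ) := by
    have h := gaussSum_mulShift χ⁻¹ ψ (-1)
    have h1 : χ⁻¹ ((-1 : (ZMod p)ˣ) : ZMod p) = -1 := by
      rw [hinv, Units.val_neg, Units.val_one, MulChar.pow_apply' χ three_ne_zero, hneg]; norm_num
    have h2 : conj (gaussSum χ ψ) = gaussSum χ⁻¹ ψ⁻¹ := star_gaussSum_eq χ ψ
    rw [h1, Units.val_neg, Units.val_one, ← AddChar.inv_mulShift, ← h2, hinv] at h
    rw [← h]; ring
  have hnormG : ‖gaussSum χ ψ‖ ^ 2 = p := by rw [norm_sq_gaussSum hχ1 hψ, ZMod.card]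
  refine hasFlatSequence_of_residueSequence hχ (B := 1 + 3 * p) fun c hc => ?_
  have hp0 : (0 : ℝ) < p := by exact_mod_cast hprime.pos
  have hcnorm : ‖c‖ = 1 := Complex.norm_eq_one_of_pow_eq_one hc (by norm_num)
  have hc3 : c ^ 3 = conj c := by
    have h1 : c * conj c = 1 := by
      rw [Complex.mul_conj, Complex.normSq_eq_norm_sq, hcnorm]; norm_num
    calc c ^ 3 = c ^ 3 * (c * conj c) := by rw [h1, mul_one]
      _ = c ^ 4 * conj c := by ring
      _ = conj c := by rw [hc, one_mul]
  simp only [Finset.sum_range_succ, Finset.sum_range_zero, zero_add, pow_zero, pow_one, one_mul]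
  rw [← hψdef, gaussSum_one_left stdAddChar_ne_one, hG3, hc3]
  -- with `z = c G(χ)` and `s = c² G(χ²)` real, the period is `-1 + s + 2 i Im z`
  have hz : (c * gaussSum χ ψ) ^ 2 = c ^ 2 * gaussSum (χ ^ 2) ψ * jacobiSum χ χ := by
    rw [mul_pow, ← hJ, mul_assoc]
  have hzn : ‖c * gaussSum χ ψ‖ ^ 2 = p := by rw [norm_mul, hcnorm, one_mul, hnormG]
  have hs' : (c ^ 2 * gaussSum (χ ^ 2) ψ) ^ 2 = p := by
    rw [mul_pow, ← pow_mul, hc, one_mul, hs]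
  have hX : -1 + c * gaussSum χ ψ + c ^ 2 * gaussSum (χ ^ 2) ψ +
      conj c * -conj (gaussSum χ ψ) =
      -1 + c ^ 2 * gaussSum (χ ^ 2) ψ + (c * gaussSum χ ψ - conj (c * gaussSum χ ψ)) := by
    rw [map_mul]; ring
  rw [hX]
  generalize c * gaussSum χ ψ = z at *
  generalize c ^ 2 * gaussSum (χ ^ 2) ψ = s at *
  generalize jacobiSum χ χ = j at *
  have hsre : s.re * s.re - s.im * s.im = p := by
    have := congrArg Complex.re hs'
    simpa [sq] using this
  have hsim : s.re * s.im = 0 := by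
    have := congrArg Complex.im hs'
    simp only [sq, Complex.mul_im, Complex.natCast_im] at this
    linarith
  have hs0 : s.im = 0 := by
    rcases mul_eq_zero.1 hsim with h | h
    · rw [h] at hsre
      nlinarith [mul_self_nonneg s.im]
    · exact h
  have hzre : z.re * z.re - z.im * z.im = -s.re := by
    have := congrArg Complex.re hz
    simpa [sq, hs0, hre] using this
  rw [← Complex.normSq_eq_norm_sq, Complex.normSq_apply] at hzn ⊢
  simp only [Complex.add_re, Complex.add_im, Complex.sub_re, Complex.sub_im, Complex.neg_re,
    Complex.neg_im, Complex.one_re, Complex.one_im, Complex.conj_re, Complex.conj_im, hs0]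
  rw [hs0] at hsre
  linarith

end Quartic

/-! ### Counting lengths -/

/-- A primality test that the kernel evaluates with a few operations on large numbers. -/
lemma prime_of_gcd_factorial_eq_one {n b : ℕ} (hn : 1 < n) (hb : n < (b + 1) ^ 2)
    (h : Nat.gcd n b.factorial = 1) : n.Prime := by
  by_contra hnp
  have hsq := Nat.minFac_sq_le_self (by omega : 0 < n) hnp
  have hle : n.minFac ≤ b :=
    Nat.lt_succ_iff.1 (lt_of_pow_lt_pow_left₀ 2 (by omega) (hsq.trans_lt hb))
  have hdvd := Nat.dvd_gcd (Nat.minFac_dvd n) (Nat.dvd_factorial n.minFac_pos hle)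
  rw [h, Nat.dvd_one, Nat.minFac_eq_one_iff] at hdvd
  omega

/-- There are enough primes `p ≡ 3 (mod 4)` with `p < 51 ^ 2`. -/
lemma count_paley :
    150 < Nat.count (fun m => Nat.gcd (103 + 4 * m) (Nat.factorial 50) = 1) 600 := by
  decide +kernel

/-- There are exactly `151` primes `p = 1 + 4 x²`, with `x ≥ 5` odd, below `10 ^ 7 < 3163 ^ 2`. The
test with the small factorial is needed for primes that divide the large one. -/
lemma count_quartic :
    150 < Nat.count (fun m => Nat.gcd (1 + 4 * (2 * m + 5) ^ 2) (Nat.factorial 56) = 1 ∧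
      (1 + 4 * (2 * m + 5) ^ 2 < 57 ^ 2 ∨
        Nat.gcd (1 + 4 * (2 * m + 5) ^ 2) (Nat.factorial 3162) = 1)) 789 := by
  decide +kernel

lemma lt_ncard_of_lt_count {S : Set ℕ} {B N : ℕ} {f : ℕ → ℕ} {P : ℕ → Prop} [DecidablePred P]
    (hS : ∀ n ∈ S, n < B) (hf : Function.Injective f)
    (hmem : ∀ m, m < N → P m → f m ∈ S) (hcount : 150 < Nat.count P N) : 150 < S.ncard := by
  have hfin : S.Finite := (Set.finite_lt_nat B).subset hS
  rw [Nat.count_eq_card_filter_range, ← Finset.card_image_of_injective _ hf,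
    ← Set.ncard_coe_finset] at hcount
  refine hcount.trans_le (Set.ncard_le_ncard ?_ hfin)
  intro n hn
  obtain ⟨m, hm, rfl⟩ := Finset.mem_image.1 (Finset.mem_coe.1 hn)
  obtain ⟨h1, h2⟩ := Finset.mem_filter.1 hm
  exact hmem m (Finset.mem_range.1 h1) h2

theorem mainTheorem2 (θ W J : ℝ) (hθ : 0 < θ) (hW : 0 ≤ W) (hJ : 0 ≤ J) (hWJ : 0 < W + J) :
    (∃ n : ℕ, 10 ^ 9 < n ∧ ∃ _ : NeZero n,
      OptimalUpTo (8 / 7) {1 / 8, 1 / 4, 1 / 2} θ W J n) ∧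
    150 < {n : ℕ | n < 10 ^ 7 ∧ ∃ _ : NeZero n,
      OptimalUpTo (4 / 3) {1 / 4, 1 / 2} θ W J n}.ncard ∧
    (∃ n : ℕ, 10 ^ 9 < n ∧ ∃ _ : NeZero n,
      OptimalUpTo (4 / 3) {1 / 4, 1 / 2} θ W J n) := by
  have singer : ∀ q ∈ ({2, 4, 8} : Set ℕ),
      ∃ n : ℕ, 10 ^ 9 < n ∧ ∃ _ : NeZero n, HasFlatSequence q n := by
    rintro q (rfl | rfl | rfl)
    · exact exists_hasFlatSequence_two_pow one_ne_zero
    · exact exists_hasFlatSequence_two_pow two_ne_zero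
    · exact exists_hasFlatSequence_two_pow three_ne_zero
  obtain ⟨q, hq, hopt⟩ := optimalUpTo_eight_sevenths hθ hW hJ hWJ
  obtain ⟨q', hq', hopt'⟩ := optimalUpTo_four_thirds hθ hW hJ hWJ
  refine ⟨?_, ?_, ?_⟩
  · obtain ⟨n, hn, hn0, hflat⟩ := singer q hq
    exact ⟨n, hn, hn0, hopt n (by omega) hflat⟩
  · rcases hq' with rfl | rfl
    · refine lt_ncard_of_lt_count (B := 10 ^ 7) (f := fun m => 103 + 4 * m) (fun n hn => hn.1)
        (fun a b h => ?_) (fun m hm hP => ?_) count_paley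
      · simp only at h; omega
      · have hp : (103 + 4 * m).Prime := prime_of_gcd_factorial_eq_one (by omega) (by omega) hP
        have hn0 : NeZero (103 + 4 * m) := ⟨hp.ne_zero⟩
        exact ⟨by omega, hn0, hopt' _ (by omega) (hasFlatSequence_paley hp (by omega))⟩
    · refine lt_ncard_of_lt_count (B := 10 ^ 7) (f := fun m => 1 + 4 * (2 * m + 5) ^ 2)
        (fun n hn => hn.1) (fun a b h => ?_) (fun m hm hP => ?_) count_quartic
      · simp only at h
        have h2 : (2 * a + 5) ^ 2 = (2 * b + 5) ^ 2 := by omega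
        have := Nat.pow_left_injective two_ne_zero h2
        omega
      · have h8 : (1 + 4 * (2 * m + 5) ^ 2) % 8 = 5 := by
          rw [show 1 + 4 * (2 * m + 5) ^ 2 = 8 * (2 * m ^ 2 + 10 * m + 12) + 5 by ring]
          omega
        have h101 : 101 ≤ 1 + 4 * (2 * m + 5) ^ 2 := by
          have := Nat.pow_le_pow_left (show 5 ≤ 2 * m + 5 by omega) 2
          omega
        have hlt : 1 + 4 * (2 * m + 5) ^ 2 < 10 ^ 7 := by
          have := Nat.pow_le_pow_left (show 2 * m + 5 ≤ 1581 by omega) 2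
          omega
        have hp : (1 + 4 * (2 * m + 5) ^ 2).Prime :=
          by
          rcases hP with ⟨h56, h57 | h3162⟩
          · exact prime_of_gcd_factorial_eq_one (by omega) h57 h56
          · exact prime_of_gcd_factorial_eq_one (by omega) (by omega) h3162
        have := Fact.mk hp
        have hn0 : NeZero (1 + 4 * (2 * m + 5) ^ 2) := ⟨hp.ne_zero⟩
        exact ⟨hlt, hn0, hopt' _ h101
          (hasFlatSequence_quartic (y := 2 * (2 * m + 5)) h8 (by push_cast; ring))⟩
  · obtain ⟨n, hn, hn0, hflat⟩ := singer q' (by rcases hq' with rfl | rfl <;> simp)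
    exact ⟨n, hn, hn0, hopt' n (by omega) hflat⟩
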